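/- Let $a<b$, $\Omega=[a,b]$ with $a$ and $b$ identified, $q\ge 1$ an integer, $\gamma=\lfloor q/2\rfloor$, $\beta\in\mathbb R$, and $L=\beta\partial_x^q$. Norms and inner products without index are those of $L^2(\Omega)$; operator norms on $V_h$ are the induced ones; $\|\cdot\|_m$ is the norm of $H^m(\Omega)$. *Spatial discretization.* For a mesh $a=x_{1/2}<x_{3/2}<\dots<x_{N+1/2}=b$ with cells $I_j=[x_{j-1/2},x_{j+1/2}]$, mesh size $h=\max_j|I_j|$, quasi-uniform with constant $\rho$ (that is, $|I_i|\le\rho|I_j|$ for all $i,j$), let $V_h$ be the space of functions whose restriction to each $I_j$ is a polynomial of degree at most $k$, $k\ge0$. With $v^\pm$ the right and left limits at the (periodic) interfaces and $[v]=v^+-v^-$, define $D_{h,\theta}:V_h\to V_h$ by $$(D_{h,\theta}w,v)=-\sum_j\int_{I_j}w\,\partial_xv\,dx-\sum_j\bigl(\theta w^-+(1-\theta)w^+\bigr)_{j+\frac12}[v]_{j+\frac12}\qquad\forall v,w\in V_h .$$ Let $\theta_1,\dots,\theta_\gamma$ and, if $q$ is odd, $\theta_0$ be real numbers, all different from $\tfrac12$.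 Put $K_h=D_{h,\theta_1}\cdots D_{h,\theta_\gamma}$ and $$L_h=(-1)^\gamma\beta K_h^\top K_h\ \ (q=2\gamma),\qquad L_h=(-1)^\gamma\beta K_h^\top D_{h,\theta_0}K_h\ \ (q=2\gamma+1);$$ equivalently $L_h=\beta D_{h,1-\theta_\gamma}\cdots D_{h,1-\theta_1}(D_{h,\theta_0})D_{h,\theta_1}\cdots D_{h,\theta_\gamma}$, the factor in parentheses being present only for odd $q$. *Projection.* For $\theta\ne\frac12$ let $D_{h,\theta}^{-1}$ be the inverse of $D_{h,\theta}$ on $Z_h=\{v\in V_h:(v,1)=0\}$, let $\Pi_0$ be the $L^2$ projection onto $V_h$, and $$\Pi w=\bigl(D_{h,\theta_\gamma}^{-1}\cdots D_{h,\theta_1}^{-1}\bigr)\bigl(D_{h,\theta_0}^{-1}\bigr)\bigl(D_{h,1-\theta_1}^{-1}\cdots D_{h,1-\theta_\gamma}^{-1}\bigr)\Pi_0\partial_x^qw+\frac{(w,1)}{(1,1)},$$ with $D_{h,\theta_0}^{-1}$ present only for odd $q$. *Time discretization.* Let $1\le p\le s$, $\alpha_0,\dots,\alpha_s\in\mathbb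 R$ with $\alpha_i=1/i!$ for $i\le p$, and $R_s(\tau L_h)=\sum_{i=0}^s\alpha_i(\tau L_h)^i$. The fully discrete scheme is $u_h^0=\Pi u(0)$, $u_h^{n+1}=R_s(\tau L_h)u_h^n$, with $t^n=n\tau$. *Claim.* For every $M$ there is a constant $C>0$ that depends only on $a,b,q,\beta,\theta_0,\dots,\theta_\gamma,k,s,p,(\alpha_i),\rho$ and $M$ such that the following holds. Let $m=k+1+q(p+2)$ and let $u$ be a solution of $\partial_tu=\beta\partial_x^qu$ on $[0,T]\times\mathbb R$, $(b-a)$-periodic and of class $C^m$ in $x$, with $\partial_t^iu=L^iu$ for $1\le i\le p+1$ and $\|u(t)\|_m\le M$ for all $t\in[0,T]$. For every mesh as above, every $0<\tau\le1$ with $\tau\|L_h\|\le\lambda$ for some $\lambda<1$, and every $\mu_h\ge0$ for which the fully discrete scheme is stable in the sense that $\|R_s(\tau L_h)\|\le1+\mu_h\tau$, one has for all $n\ge0$ with $t^n\le T$ $$\|u(t^n)-u_h^n\|\le C\bigl(\sigma(\mu_h,t^n)+1\bigr)\bigl(h^{k+1}+\tau^p\bigr),\qquad \sigma(\mu,t)=\frac{e^{\mu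 t}-1}{\mu}\ (\mu>0),\quad\sigma(0,t)=t .$$ -/

import Mathlib

open Set
open scoped Polynomial InnerProductSpace

noncomputable section

namespace LDG

/-! ### Meshes of the periodic interval -/

/-- A partition `a = x₀ < x₁ < ⋯ < x_N = b`, `N ≥ 1`, of the interval `Ω = [a, b]`, whose end points
are identified. The cells are `I_j = [x_j, x_{j+1}]`, `j : Fin N`. -/
structure Mesh (a b : ℝ) where
  N : ℕ
  N_pos : 0 < N
  x : Fin (N + 1) → ℝ
  strictMono : StrictMono x
  x_first : x 0 = a
  x_last : x (Fin.last N) = b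

namespace Mesh

variable {a b : ℝ} (T : Mesh a b)

instance : NeZero T.N := ⟨T.N_pos.ne'⟩

/-- Left end point of the cell `I_j`. -/
def left (j : Fin T.N) : ℝ := T.x j.castSucc

/-- Right end point of the cell `I_j`. -/
def right (j : Fin T.N) : ℝ := T.x j.succ

lemma left_lt_right (j : Fin T.N) : T.left j < T.right j :=
  T.strictMono (Fin.castSucc_lt_succ)

/-- Mesh size: the largest cell length. -/
def h : ℝ := ⨆ j : Fin T.N, (T.right j - T.left j)

/-- Quasi-uniformity with constant `ρ`: any two cell lengths have ratio at most `ρ`. -/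
def QuasiUniform (ρ : ℝ) : Prop :=
  ∀ i j : Fin T.N, T.right i - T.left i ≤ ρ * (T.right j - T.left j)

end Mesh

/-! ### The finite element space -/

/-- The space `V_h` of piecewise polynomials of degree at most `k`: one polynomial for each cell. -/
def Vh {a b : ℝ} (T : Mesh a b) (k : ℕ) : Type := Fin T.N → Polynomial.degreeLT ℝ (k + 1)

namespace Vh

variable {a b : ℝ} {T : Mesh a b} {k : ℕ}

instance : AddCommGroup (Vh T k) :=
  inferInstanceAs (AddCommGroup (Fin T.N → Polynomial.degreeLT ℝ (k + 1)))

instance : Module ℝ (Vh T k) :=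
  inferInstanceAs (Module ℝ (Fin T.N → Polynomial.degreeLT ℝ (k + 1)))

/-- The polynomial that represents `v` on the cell `I_j`. -/
def poly (v : Vh T k) (j : Fin T.N) : ℝ[X] := (v j : ℝ[X])

@[simp] lemma poly_add (v w : Vh T k) (j : Fin T.N) : (v + w).poly j = v.poly j + w.poly j := rfl

@[simp] lemma poly_smul (c : ℝ) (v : Vh T k) (j : Fin T.N) : (c • v).poly j = c • v.poly j := rfl

@[simp] lemma poly_zero (j : Fin T.N) : (0 : Vh T k).poly j = 0 := rfl

lemma ext_poly {v w : Vh T k} (h : ∀ j, v.poly j = w.poly j) : v = w :=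
  funext fun j => Subtype.ext (h j)

instance : FiniteDimensional ℝ (Vh T k) := by
  have : FiniteDimensional ℝ (Polynomial.degreeLT ℝ (k + 1)) :=
    LinearEquiv.finiteDimensional (Polynomial.degreeLTEquiv ℝ (k + 1)).symm
  exact inferInstanceAs (FiniteDimensional ℝ (Fin T.N → Polynomial.degreeLT ℝ (k + 1)))

lemma poly_eq_zero_of_integral {l r : ℝ} (hlr : l < r) (p : ℝ[X])
    (h : ∫ x in l..r, p.eval x * p.eval x = 0) : p = 0 := by
  by_contra hp
  have hne : ∃ c ∈ Ioo l r, p.eval c ≠ 0 := by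
    by_contra hcon
    push Not at hcon
    exact hp (Polynomial.eq_zero_of_infinite_isRoot p
      ((Ioo_infinite hlr).mono fun c hc => hcon c hc))
  obtain ⟨c, hc, hc0⟩ := hne
  have hpos : 0 < ∫ x in l..r, p.eval x * p.eval x :=
    intervalIntegral.integral_pos hlr
      (Continuous.continuousOn (by fun_prop)) (fun x _ => mul_self_nonneg _)
      ⟨c, Ioo_subset_Icc_self hc, mul_self_pos.mpr hc0⟩
  exact hpos.ne' h

/-- The `L²(Ω)` inner product `∑_j ∫_{I_j} v w dx` on `V_h`. -/
@[reducible] def innerCore : InnerProductSpace.Core ℝ (Vh T k) where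
  inner v w := ∑ j, ∫ x in (T.left j)..(T.right j), (v.poly j).eval x * (w.poly j).eval x
  conj_inner_symm v w := by
    simp [mul_comm]
  re_inner_nonneg v := by
    simp only [RCLike.re_to_real]
    exact Finset.sum_nonneg fun j _ =>
      intervalIntegral.integral_nonneg (T.left_lt_right j).le fun x _ => mul_self_nonneg _
  add_left u v w := by
    rw [← Finset.sum_add_distrib]
    refine Finset.sum_congr rfl fun j _ => ?_
    rw [← intervalIntegral.integral_add]
    · simp [add_mul]
    · exact Continuous.intervalIntegrable (by fun_prop) _ _
    · exact Continuous.intervalIntegrable (by fun_prop) _ _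
  smul_left v w c := by
    simp [Finset.mul_sum, mul_assoc]
  definite v hv := by
    have h0 := (Finset.sum_eq_zero_iff_of_nonneg fun j _ =>
      intervalIntegral.integral_nonneg (T.left_lt_right j).le
        fun x _ => mul_self_nonneg ((v.poly j).eval x)).mp hv
    exact ext_poly fun j => by
      simpa using poly_eq_zero_of_integral (T.left_lt_right j) _ (h0 j (Finset.mem_univ j))

instance : NormedAddCommGroup (Vh T k) :=
  @InnerProductSpace.Core.toNormedAddCommGroup ℝ (Vh T k) _ _ _ innerCore

instance : InnerProductSpace ℝ (Vh T k) :=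
  InnerProductSpace.ofCore innerCore.toCore

lemma inner_def (v w : Vh T k) :
    ⟪v, w⟫_ℝ = ∑ j, ∫ x in (T.left j)..(T.right j), (v.poly j).eval x * (w.poly j).eval x := rfl

/-- The constant function `c` as an element of `V_h`. -/
def const (c : ℝ) : Vh T k := fun _ =>
  ⟨Polynomial.C c, Polynomial.mem_degreeLT.mpr
    (lt_of_le_of_lt Polynomial.degree_C_le (by exact_mod_cast Nat.succ_pos k))⟩

/-- `Z_h`: the elements of `V_h` with zero mean. -/
def Zh (T : Mesh a b) (k : ℕ) : Set (Vh T k) := {v | ⟪v, const 1⟫_ℝ = 0}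

/-- The left limit `v⁻` at the interface `x_{j+1/2}`, the right end point of the cell `I_j`. -/
def traceMinus (v : Vh T k) (j : Fin T.N) : ℝ := (v.poly j).eval (T.right j)

/-- The right limit `v⁺` at the right end point of `I_j`, taken from the next cell. Addition in
`Fin N` is cyclic: the cell after the last one is the first one. -/
def tracePlus (v : Vh T k) (j : Fin T.N) : ℝ := (v.poly (j + 1)).eval (T.left (j + 1))

/-- The jump `[v] = v⁺ - v⁻`. -/
def jump (v : Vh T k) (j : Fin T.N) : ℝ := v.tracePlus j - v.traceMinus j

/-- The numerical flux `θ v⁻ + (1 - θ) v⁺`. -/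
def flux (θ : ℝ) (v : Vh T k) (j : Fin T.N) : ℝ := θ * v.traceMinus j + (1 - θ) * v.tracePlus j

/-- The form `-(w, ∂ₓ v) - ∑_j ŵ_{j+1/2} [v]_{j+1/2}`. -/
def dgForm (θ : ℝ) (w v : Vh T k) : ℝ :=
  -(∑ j, ∫ x in (T.left j)..(T.right j), (w.poly j).eval x * (v.poly j).derivative.eval x)
    - ∑ j, w.flux θ j * v.jump j

lemma dgForm_add_left (θ : ℝ) (w w' v : Vh T k) :
    dgForm θ (w + w') v = dgForm θ w v + dgForm θ w' v := by
  have h1 : ∀ j, (∫ x in (T.left j)..(T.right j),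
      ((w + w').poly j).eval x * (v.poly j).derivative.eval x) =
      (∫ x in (T.left j)..(T.right j), (w.poly j).eval x * (v.poly j).derivative.eval x) +
      ∫ x in (T.left j)..(T.right j), (w'.poly j).eval x * (v.poly j).derivative.eval x := by
    intro j
    rw [← intervalIntegral.integral_add]
    · simp [add_mul]
    · exact Continuous.intervalIntegrable (by fun_prop) _ _
    · exact Continuous.intervalIntegrable (by fun_prop) _ _
  have h2 : ∀ j, (w + w').flux θ j * v.jump j = w.flux θ j * v.jump j + w'.flux θ j * v.jump j := by
    intro j
    simp only [flux, traceMinus, tracePlus, poly_add, Polynomial.eval_add]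
    ring
  simp only [dgForm, h1, h2, Finset.sum_add_distrib]
  ring

lemma dgForm_smul_left (θ c : ℝ) (w v : Vh T k) :
    dgForm θ (c • w) v = c * dgForm θ w v := by
  have h1 : ∀ j, (∫ x in (T.left j)..(T.right j),
      ((c • w).poly j).eval x * (v.poly j).derivative.eval x) =
      c * ∫ x in (T.left j)..(T.right j), (w.poly j).eval x * (v.poly j).derivative.eval x := by
    intro j
    simp [mul_assoc]
  have h2 : ∀ j, (c • w).flux θ j * v.jump j = c * (w.flux θ j * v.jump j) := by
    intro j
    simp only [flux, traceMinus, tracePlus, poly_smul, Polynomial.eval_smul, smul_eq_mul]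
    ring
  simp only [dgForm, h1, h2, ← Finset.mul_sum]
  ring

lemma dgForm_add_right (θ : ℝ) (w v v' : Vh T k) :
    dgForm θ w (v + v') = dgForm θ w v + dgForm θ w v' := by
  have h1 : ∀ j, (∫ x in (T.left j)..(T.right j),
      (w.poly j).eval x * ((v + v').poly j).derivative.eval x) =
      (∫ x in (T.left j)..(T.right j), (w.poly j).eval x * (v.poly j).derivative.eval x) +
      ∫ x in (T.left j)..(T.right j), (w.poly j).eval x * (v'.poly j).derivative.eval x := by
    intro j
    rw [← intervalIntegral.integral_add]
    · simp [mul_add]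
    · exact Continuous.intervalIntegrable (by fun_prop) _ _
    · exact Continuous.intervalIntegrable (by fun_prop) _ _
  have h2 : ∀ j, w.flux θ j * (v + v').jump j = w.flux θ j * v.jump j + w.flux θ j * v'.jump j := by
    intro j
    simp only [jump, traceMinus, tracePlus, poly_add, Polynomial.eval_add]
    ring
  simp only [dgForm, h1, h2, Finset.sum_add_distrib]
  ring

lemma dgForm_smul_right (θ c : ℝ) (w v : Vh T k) :
    dgForm θ w (c • v) = c * dgForm θ w v := by
  have h1 : ∀ j, (∫ x in (T.left j)..(T.right j),
      (w.poly j).eval x * ((c • v).poly j).derivative.eval x) =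
      c * ∫ x in (T.left j)..(T.right j), (w.poly j).eval x * (v.poly j).derivative.eval x := by
    intro j
    rw [← intervalIntegral.integral_const_mul]
    simp [mul_left_comm]
  have h2 : ∀ j, w.flux θ j * (c • v).jump j = c * (w.flux θ j * v.jump j) := by
    intro j
    simp only [jump, traceMinus, tracePlus, poly_smul, Polynomial.eval_smul, smul_eq_mul]
    ring
  simp only [dgForm, h1, h2, ← Finset.mul_sum]
  ring

/-- The form `dgForm θ w ·` as a linear functional on `V_h`. -/
def dgFunctional (θ : ℝ) (w : Vh T k) : Vh T k →ₗ[ℝ] ℝ where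
  toFun v := dgForm θ w v
  map_add' := dgForm_add_right θ w
  map_smul' c v := by simpa using dgForm_smul_right θ c w v

/-- The Riesz representative in `V_h` of a linear functional on `V_h`. -/
def riesz (ℓ : Vh T k →ₗ[ℝ] ℝ) : Vh T k :=
  haveI := FiniteDimensional.complete ℝ (Vh T k)
  (InnerProductSpace.toDual ℝ (Vh T k)).symm (LinearMap.toContinuousLinearMap ℓ)

lemma inner_riesz (ℓ : Vh T k →ₗ[ℝ] ℝ) (v : Vh T k) : ⟪riesz ℓ, v⟫_ℝ = ℓ v := by
  have := FiniteDimensional.complete ℝ (Vh T k)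
  simp [riesz]

/-- The discontinuous Galerkin operator `D_{h,θ} : V_h → V_h` approximating `∂ₓ`. -/
def D (T : Mesh a b) (k : ℕ) (θ : ℝ) : Vh T k →ₗ[ℝ] Vh T k where
  toFun w := riesz (dgFunctional θ w)
  map_add' w w' := by
    refine ext_inner_right ℝ fun v => ?_
    rw [inner_add_left, inner_riesz, inner_riesz, inner_riesz]
    exact dgForm_add_left θ w w' v
  map_smul' c w := by
    refine ext_inner_right ℝ fun v => ?_
    rw [RingHom.id_apply, real_inner_smul_left, inner_riesz, inner_riesz]
    exact dgForm_smul_left θ c w v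

/-- The variational identity that determines `D_{h,θ}`. -/
lemma inner_D (θ : ℝ) (w v : Vh T k) : ⟪D T k θ w, v⟫_ℝ = dgForm θ w v :=
  inner_riesz _ v

/-- The inverse of `D_{h,θ} : Z_h → Z_h`: the value at `y` is the element of `Z_h` that
`D_{h,θ}` maps to `y`. -/
def Dinv (θ : ℝ) (y : Vh T k) : Vh T k := Function.invFunOn (D T k θ) (Zh T k) y

/-- `K_h = D_{h,θ₁} D_{h,θ₂} ⋯ D_{h,θ_γ}`. -/
def K (T : Mesh a b) (k : ℕ) {γ : ℕ} (θ : Fin γ → ℝ) : Module.End ℝ (Vh T k) :=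
  (List.ofFn fun i => D T k (θ i)).prod

/-- The operator `L_h` approximating `β ∂ₓ^q`: with `γ = ⌊q/2⌋`, it is
`(-1)^γ β K_hᵀ K_h` if `q = 2γ` and `(-1)^γ β K_hᵀ D_{h,θ₀} K_h` if `q = 2γ + 1`.
As `K_hᵀ = (-1)^γ D_{h,1-θ_γ} ⋯ D_{h,1-θ₁}`, the sign makes it equal to
`β D_{h,1-θ_γ} ⋯ D_{h,1-θ₁} (D_{h,θ₀}) D_{h,θ₁} ⋯ D_{h,θ_γ}`. -/
def Lh (T : Mesh a b) (k q : ℕ) (β θ₀ : ℝ) (θ : Fin (q / 2) → ℝ) : Module.End ℝ (Vh T k) :=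
  ((-1) ^ (q / 2) * β) •
    (if Even q then LinearMap.adjoint (K T k θ) * K T k θ
      else LinearMap.adjoint (K T k θ) * D T k θ₀ * K T k θ)

/-- The Runge-Kutta operator `R_s(τ A) = ∑_{i=0}^s α_i (τ A)^i`. -/
def R (s : ℕ) (α : ℕ → ℝ) (τ : ℝ) (A : Module.End ℝ (Vh T k)) : Module.End ℝ (Vh T k) :=
  ∑ i ∈ Finset.range (s + 1), α i • (τ • A) ^ i

/-- The operator norm on `V_h` induced by the `L²` norm. -/
def opNorm (A : Module.End ℝ (Vh T k)) : ℝ := ‖LinearMap.toContinuousLinearMap A‖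

/-! ### Projections and the `L²` error -/

/-- The `L²(Ω)` pairing of a function with an element of `V_h`. -/
def pairing (w : ℝ → ℝ) (v : Vh T k) : ℝ :=
  ∑ j, ∫ x in (T.left j)..(T.right j), w x * (v.poly j).eval x

/-- The `L²` projection `Π₀` onto `V_h`, written in an orthonormal basis of `V_h`. -/
def proj0 (T : Mesh a b) (k : ℕ) (w : ℝ → ℝ) : Vh T k :=
  ∑ i, pairing w (stdOrthonormalBasis ℝ (Vh T k) i) • stdOrthonormalBasis ℝ (Vh T k) i

/-- The identity that determines `Π₀ w`. -/
lemma inner_proj0 {w : ℝ → ℝ} (hw : Continuous w) (v : Vh T k) :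
    ⟪proj0 T k w, v⟫_ℝ = pairing w v := by
  have hadd : ∀ v v' : Vh T k, pairing w (v + v') = pairing w v + pairing w v' := by
    intro v v'
    rw [pairing, pairing, pairing, ← Finset.sum_add_distrib]
    refine Finset.sum_congr rfl fun j _ => ?_
    rw [← intervalIntegral.integral_add]
    · simp [mul_add]
    · exact Continuous.intervalIntegrable (by fun_prop) _ _
    · exact Continuous.intervalIntegrable (by fun_prop) _ _
  have hsmul : ∀ (c : ℝ) (v : Vh T k), pairing w (c • v) = c * pairing w v := by
    intro c v
    rw [pairing, pairing, Finset.mul_sum]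
    refine Finset.sum_congr rfl fun j _ => ?_
    rw [← intervalIntegral.integral_const_mul]
    simp [mul_left_comm]
  let ℓ : Vh T k →ₗ[ℝ] ℝ :=
    { toFun := pairing w, map_add' := hadd, map_smul' := fun c v => by simpa using hsmul c v }
  have h1 : ℓ v = ℓ (∑ i, ⟪stdOrthonormalBasis ℝ (Vh T k) i, v⟫_ℝ •
      stdOrthonormalBasis ℝ (Vh T k) i) := by
    rw [OrthonormalBasis.sum_repr']
  change _ = ℓ v
  rw [h1, map_sum, proj0, sum_inner]
  refine Finset.sum_congr rfl fun i _ => ?_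
  rw [map_smul, real_inner_smul_left, smul_eq_mul, mul_comm]
  rfl

/-- The operator `Π`, with `γ = ⌊q/2⌋`:
`(D_{h,θ_γ}⁻¹ ⋯ D_{h,θ₁}⁻¹) (D_{h,θ₀}⁻¹) (D_{h,1-θ₁}⁻¹ ⋯ D_{h,1-θ_γ}⁻¹) Π₀ ∂ₓ^q w + (w,1)/(1,1)`,
where the factor `D_{h,θ₀}⁻¹` is present only if `q` is odd. -/
def proj (T : Mesh a b) (k q : ℕ) (θ₀ : ℝ) (θ : Fin (q / 2) → ℝ) (w : ℝ → ℝ) : Vh T k :=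
  let y₁ := (List.ofFn θ).foldr (fun t v => Dinv (1 - t) v) (proj0 T k (iteratedDeriv q w))
  let y₂ := if Even q then y₁ else Dinv θ₀ y₁
  (List.ofFn θ).foldl (fun v t => Dinv t v) y₂ + const ((∫ x in a..b, w x) / (b - a))

/-- The `L²(Ω)` norm `‖w - v_h‖`. -/
def l2Error (w : ℝ → ℝ) (v : Vh T k) : ℝ :=
  √(∑ j, ∫ x in (T.left j)..(T.right j), (w x - (v.poly j).eval x) ^ 2)

end Vh

/-! ### The continuous problem -/

/-- The Sobolev norm `‖w‖_m` on `Ω = [a, b]` (of a function of class `C^m`). -/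
def sobolevNorm (a b : ℝ) (m : ℕ) (w : ℝ → ℝ) : ℝ :=
  √(∑ i ∈ Finset.range (m + 1), ∫ x in a..b, (iteratedDeriv i w x) ^ 2)

/-- The differential operator `L = β ∂ₓ^q`. -/
def Lop (β : ℝ) (q : ℕ) (w : ℝ → ℝ) : ℝ → ℝ := fun x => β * iteratedDeriv q w x

/-- `u = u(t, x)` is a solution of `∂ₜ u = β ∂ₓ^q u` for `t ∈ [0, t_end]`, `(b - a)`-periodic and of
class `C^m` in `x`, and with `∂ₜ^i u = L^i u` for `1 ≤ i ≤ p + 1` (for `i = 1` this is the equation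
itself). -/
structure IsSmoothSolution (a b β : ℝ) (q p m : ℕ) (tEnd : ℝ) (u : ℝ → ℝ → ℝ) : Prop where
  periodic : ∀ t ∈ Icc 0 tEnd, Function.Periodic (u t) (b - a)
  contDiff : ∀ t ∈ Icc 0 tEnd, ContDiff ℝ m (u t)
  time_deriv : ∀ i ≤ p, ∀ t ∈ Icc 0 tEnd, ∀ x : ℝ,
    HasDerivWithinAt (fun r => (Lop β q)^[i] (u r) x) ((Lop β q)^[i + 1] (u t) x) (Icc 0 tEnd) t

/-- The function `σ(μ, t) = (e^{μt} - 1)/μ` for `μ > 0`, and `σ(0, t) = t`. -/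
def sigma (μ t : ℝ) : ℝ := if μ = 0 then t else (Real.exp (μ * t) - 1) / μ

end LDG

end

/-!
The operator `L_h` is `β` times a product of `q` operators `D_{h,t}`, `t ≠ 1/2`, and `Π` inverts
that product on the functions of zero mean, so that `L_h Π w = Π₀ L w`. For a product of first-
order operators, the error `Π w - Π₀ w` is peeled off one factor at a time. The generalized
Gauss-Radau projection `P`, which is unique because `t ≠ 1/2`, satisfies `D_{h,t} P w = Π₀ w'`,
and it differs from `w` by `O(h^{k+1})`. It also shows that `D_{h,t}` satisfies a Poincaré
inequality on `Z_h`, uniformly in the mesh: by duality, the norm of `v` is tested against `P` of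
a primitive of `v`. Hence `‖Π w - Π₀ w‖ = O(h^{k+1})`, and `Π` is bounded in terms of `w` and
`∂ₓ^q w`.

As `τ ‖L_h‖` is bounded, replacing `L_h^i Π u` by `Π L^i u` costs `O(τ h^{k+1} + τ^{p+1})` in
one step of the Runge-Kutta method, which leaves the Taylor polynomial of `Π u(t + τ)` in `τ`.
Stability accumulates these local errors to `σ(μ_h, t^n) (h^{k+1} + τ^p)`.
-/

noncomputable section

namespace LDG

section Cell

open Polynomial

variable {k n : ℕ} {l r : ℝ}

/-! ### Polynomials on a cell -/

lemma integral_eq_sub_mul_integral_unit (f : ℝ → ℝ) (l r : ℝ) :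
    ∫ x in l..r, f x = (r - l) * ∫ y in (0 : ℝ)..1, f (r - (r - l) * y) := by
  simp

lemma derivative_mem_degreeLT {Q : ℝ[X]} (hQ : Q ∈ ℝ[X]_(n + 1)) : derivative Q ∈ ℝ[X]_n := by
  rw [mem_degreeLT, degree_lt_iff_coeff_zero] at hQ ⊢
  intro i hi
  rw [coeff_derivative, hQ (i + 1) (by lia), zero_mul]

lemma comp_affine_mem_degreeLT {Q : ℝ[X]} (hQ : Q ∈ ℝ[X]_n) (c d : ℝ) :
    Q.comp (C c - C d * X) ∈ ℝ[X]_n := by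
  rcases eq_or_ne Q 0 with rfl | hQ0
  · simp
  rw [mem_degreeLT, ← natDegree_lt_iff_degree_lt hQ0] at hQ
  have haffine : (C c - C d * X).natDegree ≤ 1 := by compute_degree
  refine mem_degreeLT.mpr ((degree_le_natDegree).trans_lt (Nat.cast_lt.mpr ?_))
  calc (Q.comp (C c - C d * X)).natDegree ≤ Q.natDegree * (C c - C d * X).natDegree :=
        natDegree_comp_le
    _ ≤ Q.natDegree := mul_le_of_le_one_right' haffine
    _ < n := hQ

lemma eval_iterate_derivative_eq_zero_of_pow_dvd {G : ℝ[X]} {c : ℝ} (hG : (X - C c) ^ (n + 1) ∣ G) :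
    (derivative^[n] G).eval c = 0 := by
  have h := pow_sub_dvd_iterate_derivative_of_pow_dvd n hG
  rw [Nat.add_sub_cancel_left, pow_one] at h
  exact dvd_iff_isRoot.mp h

lemma integral_iterate_derivative_mul_eq_zero {G Q : ℝ[X]} (hl : (X - C l) ^ n ∣ G)
    (hr : (X - C r) ^ n ∣ G) (hQ : Q ∈ ℝ[X]_n) :
    ∫ x in l..r, (derivative^[n] G).eval x * Q.eval x = 0 := by
  induction n generalizing Q with
  | zero =>
    have hQ0 : Q = 0 := degree_eq_bot.mp (by simpa using mem_degreeLT.mp hQ)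
    simp [hQ0]
  | succ n ih =>
    have hparts := intervalIntegral.integral_mul_deriv_eq_deriv_mul
      (a := l) (b := r) (u := fun x => Q.eval x) (v := fun x => (derivative^[n] G).eval x)
      (v' := fun x => (derivative^[n + 1] G).eval x)
      (fun x _ => Q.hasDerivAt x)
      (fun x _ => by
        rw [Function.iterate_succ_apply']
        exact Polynomial.hasDerivAt _ x)
      (Continuous.intervalIntegrable (by fun_prop) _ _)
      (Continuous.intervalIntegrable (by fun_prop) _ _)
    rw [eval_iterate_derivative_eq_zero_of_pow_dvd hl,
      eval_iterate_derivative_eq_zero_of_pow_dvd hr] at hparts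
    have hlower := ih ((pow_dvd_pow _ n.le_succ).trans hl) ((pow_dvd_pow _ n.le_succ).trans hr)
      (derivative_mem_degreeLT hQ)
    simp only [mul_comm (eval _ (_^[_] _))] at hlower ⊢
    rw [hparts, hlower]
    ring

/-- The Legendre polynomial of the reference cell `[0, 1]`, with value `1` at `0`. -/
def legendreUnit (k : ℕ) : ℝ[X] := (shiftedLegendre k).map (Int.castRingHom ℝ)

lemma eval_legendreUnit_zero (k : ℕ) : (legendreUnit k).eval 0 = 1 := by
  rw [← coeff_zero_eq_eval_zero, legendreUnit, coeff_map, coeff_shiftedLegendre]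
  simp

lemma eval_legendreUnit_one (k : ℕ) : (legendreUnit k).eval 1 = (-1) ^ k := by
  have haeval (x : ℝ) : aeval x (shiftedLegendre k) = (legendreUnit k).eval x := by
    rw [legendreUnit, eval_map, aeval_def]
    rfl
  simpa [haeval, eval_legendreUnit_zero] using shiftedLegendre_eval_symm k (1 : ℝ)

lemma legendreUnit_mem_degreeLT (k : ℕ) : legendreUnit k ∈ ℝ[X]_(k + 1) := by
  refine mem_degreeLT.mpr (degree_map_le.trans_lt ?_)
  rw [degree_shiftedLegendre]
  exact_mod_cast k.lt_succ_self

lemma integral_legendreUnit_mul_eq_zero {Q : ℝ[X]} (hQ : Q ∈ ℝ[X]_k) :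
    ∫ x in (0 : ℝ)..1, (legendreUnit k).eval x * Q.eval x = 0 := by
  have hrodrigues :
      (k.factorial : ℝ[X]) * legendreUnit k = derivative^[k] (X ^ k * (1 - X) ^ k) := by
    simpa [legendreUnit, ← iterate_derivative_map] using
      congrArg (Polynomial.map (Int.castRingHom ℝ)) (factorial_mul_shiftedLegendre_eq k)
  have hone : (X - C 1 : ℝ[X]) ∣ 1 - X := ⟨-1, by simp⟩
  have h := integral_iterate_derivative_mul_eq_zero (l := 0) (r := 1)
    (G := X ^ k * (1 - X) ^ k) (by simp) ((pow_dvd_pow_of_dvd hone k).mul_left _) hQ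
  simp only [← hrodrigues, eval_mul, eval_natCast, mul_assoc,
    intervalIntegral.integral_const_mul] at h
  exact (mul_eq_zero.mp h).resolve_left (by exact_mod_cast k.factorial_ne_zero)

/-- The Legendre polynomial of degree `k` of the cell `[l, r]`, with value `1` at `r`. -/
def legendreCell (k : ℕ) (l r : ℝ) : ℝ[X] :=
  (legendreUnit k).comp (C (r / (r - l)) - C (1 / (r - l)) * X)

lemma eval_legendreCell (k : ℕ) (l r x : ℝ) :
    (legendreCell k l r).eval x = (legendreUnit k).eval ((r - x) / (r - l)) := by
  simp only [legendreCell, eval_comp, eval_sub, eval_C, eval_mul, eval_X]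
  ring_nf

lemma eval_legendreCell_right (k : ℕ) (l r : ℝ) : (legendreCell k l r).eval r = 1 := by
  simp [eval_legendreCell, eval_legendreUnit_zero]

lemma eval_legendreCell_left (k : ℕ) (hlr : l < r) : (legendreCell k l r).eval l = (-1) ^ k := by
  rw [eval_legendreCell, div_self (sub_pos.mpr hlr).ne', eval_legendreUnit_one]

lemma legendreCell_mem_degreeLT (k : ℕ) (l r : ℝ) : legendreCell k l r ∈ ℝ[X]_(k + 1) :=
  comp_affine_mem_degreeLT (legendreUnit_mem_degreeLT k) _ _

lemma integral_legendreCell_mul_eq_zero (hlr : l < r) {Q : ℝ[X]} (hQ : Q ∈ ℝ[X]_k) :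
    ∫ x in l..r, (legendreCell k l r).eval x * Q.eval x = 0 := by
  have h := integral_legendreUnit_mul_eq_zero (comp_affine_mem_degreeLT hQ r (r - l))
  simp only [eval_comp, eval_sub, eval_C, eval_mul, eval_X] at h
  rw [integral_eq_sub_mul_integral_unit]
  simp [eval_legendreCell, (sub_pos.mpr hlr).ne', h]

lemma sub_div_sub_mem_unitInterval {x : ℝ} (hlr : l < r) (hx : x ∈ Icc l r) :
    (r - x) / (r - l) ∈ Icc (0 : ℝ) 1 := by
  have hpos := sub_pos.mpr hlr
  rw [mem_Icc, div_le_one hpos]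
  exact ⟨div_nonneg (sub_nonneg.mpr hx.2) hpos.le, by linarith [hx.1]⟩

lemma exists_abs_eval_legendreCell_le (k : ℕ) : ∃ B : ℝ, 0 ≤ B ∧ ∀ l r : ℝ, l < r →
    ∀ x ∈ Icc l r, |(legendreCell k l r).eval x| ≤ B := by
  obtain ⟨B, hB⟩ := (isCompact_Icc (a := (0 : ℝ)) (b := 1)).exists_bound_of_continuousOn
    (legendreUnit k).continuous.continuousOn
  refine ⟨B, (norm_nonneg _).trans (hB 0 (by simp)), fun l r hlr x hx => ?_⟩
  rw [eval_legendreCell]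
  exact hB _ (sub_div_sub_mem_unitInterval hlr hx)

/-- The mesh of `[0, 1]` with a single cell. Its space `V_h` carries the `L²(0, 1)` norm on the
polynomials of degree at most `k`. -/
def unitMesh : Mesh 0 1 where
  N := 1
  N_pos := one_pos
  x := ![0, 1]
  strictMono := by simp [Fin.strictMono_iff_lt_succ]
  x_first := rfl
  x_last := rfl

lemma exists_sq_eval_le_integral_unit (k : ℕ) : ∃ B : ℝ, 0 ≤ B ∧ ∀ p ∈ ℝ[X]_(k + 1),
    ∀ x ∈ Icc (0 : ℝ) 1, p.eval x ^ 2 ≤ B * ∫ y in (0 : ℝ)..1, p.eval y ^ 2 := by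
  let restrict : Vh unitMesh k →ₗ[ℝ] C(Icc (0 : ℝ) 1, ℝ) :=
    { toFun v := (v.poly 0).toContinuousMapOn _
      map_add' v w := by ext; simp
      map_smul' c v := by ext; simp }
  set A := ‖LinearMap.toContinuousLinearMap restrict‖
  refine ⟨A ^ 2, sq_nonneg A, fun p hp x hx => ?_⟩
  let v : Vh unitMesh k := fun _ => ⟨p, hp⟩
  have hnorm : ‖v‖ ^ 2 = ∫ y in (0 : ℝ)..1, p.eval y ^ 2 := by
    rw [← real_inner_self_eq_norm_sq, Vh.inner_def]
    simp only [sq]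
    exact Fin.sum_univ_one _
  have heval : |p.eval x| ≤ A * ‖v‖ :=
    ((restrict v).norm_coe_le_norm ⟨x, hx⟩).trans
      ((LinearMap.toContinuousLinearMap restrict).le_opNorm v)
  calc p.eval x ^ 2 = |p.eval x| ^ 2 := (sq_abs _).symm
    _ ≤ (A * ‖v‖) ^ 2 := by gcongr
    _ = A ^ 2 * ∫ y in (0 : ℝ)..1, p.eval y ^ 2 := by rw [mul_pow, hnorm]

lemma exists_sq_eval_le_integral_cell (k : ℕ) : ∃ B : ℝ, 0 ≤ B ∧ ∀ l r : ℝ, l < r →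
    ∀ p ∈ ℝ[X]_(k + 1), ∀ x ∈ Icc l r,
      (r - l) * p.eval x ^ 2 ≤ B * ∫ y in l..r, p.eval y ^ 2 := by
  obtain ⟨B, hB, hunit⟩ := exists_sq_eval_le_integral_unit k
  refine ⟨B, hB, fun l r hlr p hp x hx => ?_⟩
  have hpos := sub_pos.mpr hlr
  have h := hunit _ (comp_affine_mem_degreeLT hp r (r - l)) _ (sub_div_sub_mem_unitInterval hlr hx)
  simp only [eval_comp, eval_sub, eval_C, eval_mul, eval_X, mul_div_cancel₀ _ hpos.ne',
    sub_sub_cancel] at h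
  rw [integral_eq_sub_mul_integral_unit, mul_left_comm]
  gcongr

lemma exists_polynomial_abs_sub_le {f : ℝ → ℝ} (hf : ContDiff ℝ (k + 1 : ℕ) f) {W : ℝ}
    (hlr : l < r) (hW : ∀ x, |iteratedDeriv (k + 1) f x| ≤ W) :
    ∃ p ∈ ℝ[X]_(k + 1), ∀ x ∈ Icc l r, |f x - p.eval x| ≤ W * (r - l) ^ (k + 1) := by
  have hW0 : 0 ≤ W := (abs_nonneg _).trans (hW 0)
  refine ⟨∑ i ∈ Finset.range (k + 1),
    ((i.factorial : ℝ)⁻¹ * iteratedDerivWithin i f (Icc l r) l) • (X - C l) ^ i,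
    Submodule.sum_mem _ fun i hi => Submodule.smul_mem _ _ ?_, fun x hx => ?_⟩
  · rw [mem_degreeLT, degree_pow, degree_X_sub_C, nsmul_one]
    exact_mod_cast Finset.mem_range.mp hi
  have htaylor := taylor_mean_remainder_bound (C := W) hlr.le (by exact_mod_cast hf.contDiffOn) hx
    fun y hy => by
      rw [iteratedDerivWithin_eq_iteratedDeriv (uniqueDiffOn_Icc hlr) hf.contDiffAt hy]
      exact hW y
  simp only [taylor_within_apply, smul_eq_mul, mul_right_comm _ (_ ^ _)] at htaylor
  simp only [eval_finsetSum, eval_smul, eval_pow, eval_sub, eval_X, eval_C, smul_eq_mul]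
  refine htaylor.trans ?_
  calc W * (x - l) ^ (k + 1) / k.factorial ≤ W * (x - l) ^ (k + 1) :=
        div_le_self (mul_nonneg hW0 (pow_nonneg (sub_nonneg.mpr hx.1) _))
          (by exact_mod_cast k.factorial_pos)
    _ ≤ W * (r - l) ^ (k + 1) := by
        have hx0 := sub_nonneg.mpr hx.1
        have hxr := hx.2
        gcongr

lemma exists_abs_eval_le_of_integral_sq_eq (k : ℕ) : ∃ S : ℝ, 0 ≤ S ∧ ∀ l r : ℝ, l < r →
    ∀ P ∈ ℝ[X]_(k + 1), ∀ f : ℝ → ℝ, Continuous f →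
    (∫ x in l..r, P.eval x * P.eval x = ∫ x in l..r, f x * P.eval x) →
    ∀ W : ℝ, (∀ x ∈ Icc l r, |f x| ≤ W) → ∀ x ∈ Icc l r, |P.eval x| ≤ S * W := by
  obtain ⟨B, hB, hinverse⟩ := exists_sq_eval_le_integral_cell k
  refine ⟨√B, B.sqrt_nonneg, fun l r hlr P hP f hf hm W hW x hx => ?_⟩
  have hpos := sub_pos.mpr hlr
  have hW0 : 0 ≤ W := (abs_nonneg _).trans (hW x hx)
  have hyoung : ∫ x in l..r, f x * P.eval x ≤ ∫ x in l..r, (W ^ 2 + P.eval x * P.eval x) / 2 := by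
    refine intervalIntegral.integral_mono_on hlr.le
      (Continuous.intervalIntegrable (by fun_prop) _ _)
      (Continuous.intervalIntegrable (by fun_prop) _ _) fun y hy => ?_
    have hfy : f y ^ 2 ≤ W ^ 2 := sq_le_sq.mpr ((hW y hy).trans (le_abs_self W))
    linarith [two_mul_le_add_sq (f y) (P.eval y)]
  rw [intervalIntegral.integral_div, intervalIntegral.integral_add
    (Continuous.intervalIntegrable (by fun_prop) _ _)
    (Continuous.intervalIntegrable (by fun_prop) _ _), intervalIntegral.integral_const,
    smul_eq_mul, ← hm] at hyoung
  have hL2 : ∫ x in l..r, P.eval x ^ 2 ≤ (r - l) * W ^ 2 := by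
    simp only [sq (P.eval _)]
    linarith
  refine abs_le_of_sq_le_sq ?_ (by positivity)
  rw [mul_pow, Real.sq_sqrt hB]
  refine le_of_mul_le_mul_left ?_ hpos
  calc (r - l) * P.eval x ^ 2 ≤ B * ∫ y in l..r, P.eval y ^ 2 := hinverse l r hlr P hP x hx
    _ ≤ B * ((r - l) * W ^ 2) := by gcongr
    _ = (r - l) * (B * W ^ 2) := by ring

end Cell

lemma norm_comp_equiv {ι : Type*} [Fintype ι] (e : ι ≃ ι) (c : ι → ℝ) : ‖c ∘ e‖ = ‖c‖ := by
  refine le_antisymm ((pi_norm_le_iff_of_nonneg (norm_nonneg _)).mpr fun j => norm_le_pi_norm c _)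
    ((pi_norm_le_iff_of_nonneg (norm_nonneg _)).mpr fun j => ?_)
  simpa using norm_le_pi_norm (c ∘ e) (e.symm j)

lemma exists_mul_add_mul_comp_equiv_eq {ι : Type*} [Fintype ι] (e : ι ≃ ι) {A B : ℝ}
    (hAB : |A| ≠ |B|) (r : ι → ℝ) :
    ∃ c : ι → ℝ, (∀ j, A * c j + B * c (e j) = r j) ∧ |(|A| - |B|)| * ‖c‖ ≤ ‖r‖ := by
  let Φ : (ι → ℝ) →ₗ[ℝ] (ι → ℝ) := A • LinearMap.id + B • LinearMap.funLeft ℝ ℝ e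
  have hbound (c : ι → ℝ) : |(|A| - |B|)| * ‖c‖ ≤ ‖Φ c‖ := by
    calc |(|A| - |B|)| * ‖c‖ = |(|A| - |B|) * ‖c‖| := by rw [abs_mul, abs_norm]
      _ = |‖A • c‖ - ‖-(B • (c ∘ e))‖| := by
        rw [norm_neg, norm_smul, norm_smul, norm_comp_equiv, sub_mul, Real.norm_eq_abs,
          Real.norm_eq_abs]
      _ ≤ ‖A • c - -(B • (c ∘ e))‖ := abs_norm_sub_norm_le _ _
      _ = ‖Φ c‖ := by rw [sub_neg_eq_add]; rfl
  have hinj : Function.Injective Φ := (injective_iff_map_eq_zero Φ).mpr fun c hc => by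
    have h := hbound c
    rw [hc, norm_zero] at h
    exact norm_le_zero_iff.mp
      (nonpos_of_mul_nonpos_right h (abs_pos.mpr (sub_ne_zero.mpr hAB)))
  obtain ⟨c, rfl⟩ := LinearMap.injective_iff_surjective.mp hinj r
  exact ⟨c, fun j => rfl, hbound c⟩

lemma apply_castSucc_add_one {X : Type*} {N : ℕ} [NeZero N] {F : Fin (N + 1) → X}
    (hF : F 0 = F (Fin.last N)) (j : Fin N) : F (j + 1).castSucc = F j.succ := by
  rcases lt_or_ge ((j : ℕ) + 1) N with hlt | hge
  · congr 1
    exact Fin.ext (by rw [Fin.val_castSucc, Fin.val_succ, Fin.val_add_one_of_lt' hlt])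
  · have hj : (j : ℕ) + 1 = N := by lia
    have hlast : j.succ = Fin.last N := Fin.ext (by simpa using hj)
    have hfirst : (j + 1).castSucc = 0 := Fin.ext (by simp [Fin.val_add, hj])
    rw [hlast, hfirst, hF]

lemma exists_cyclic_primitive {N : ℕ} [NeZero N] {f : Fin N → ℝ} (hf : ∑ j, f j = 0) :
    ∃ S : Fin N → ℝ, (∀ j, S (j + 1) = S j + f j) ∧ ∀ j, |S j| ≤ ∑ i, |f i| := by
  let F : Fin (N + 1) → ℝ := fun i => ∑ j, if j.castSucc < i then f j else 0
  have hF : F 0 = F (Fin.last N) := by simp [F, hf, Fin.castSucc_lt_last]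
  have hsucc (j : Fin N) : F j.succ = F j.castSucc + f j := by
    have hterm (i : Fin N) : (if i.castSucc < j.succ then f i else 0) =
        (if i.castSucc < j.castSucc then f i else 0) + if i = j then f i else 0 := by
      rcases lt_trichotomy i j with h | rfl | h
      · simp [Fin.castSucc_lt_succ_iff, h, h.le, h.ne]
      · simp
      · simp [Fin.castSucc_lt_succ_iff, h.not_ge, h.not_gt, h.ne']
    simp only [F, hterm, Finset.sum_add_distrib, Finset.sum_ite_eq', Finset.mem_univ, if_true]
  refine ⟨fun j => F j.castSucc, fun j => (apply_castSucc_add_one hF j).trans (hsucc j),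
    fun j => (Finset.abs_sum_le_sum_abs _ _).trans (Finset.sum_le_sum fun i _ => ?_)⟩
  split_ifs
  · exact le_rfl
  · simp

namespace Mesh

variable {a b : ℝ} (T : Mesh a b)

/-! ### Sums over the cells of a mesh -/

lemma sub_le_h (j : Fin T.N) : T.right j - T.left j ≤ T.h :=
  le_ciSup (f := fun j => T.right j - T.left j) (Set.finite_range _).bddAbove j

lemma h_pos : 0 < T.h :=
  (sub_pos.mpr (T.left_lt_right 0)).trans_le (T.sub_le_h 0)

lemma left_mem_cell (j : Fin T.N) : T.left j ∈ Icc (T.left j) (T.right j) :=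
  left_mem_Icc.mpr (T.left_lt_right j).le

lemma right_mem_cell (j : Fin T.N) : T.right j ∈ Icc (T.left j) (T.right j) :=
  right_mem_Icc.mpr (T.left_lt_right j).le

lemma sum_right_sub_left (F : ℝ → ℝ) : ∑ j, (F (T.right j) - F (T.left j)) = F b - F a := by
  have hfirst := Fin.sum_univ_succ (fun i => F (T.x i))
  have hlast := Fin.sum_univ_castSucc (fun i => F (T.x i))
  rw [T.x_first] at hfirst
  rw [T.x_last] at hlast
  rw [Finset.sum_sub_distrib]
  simp only [right, left]
  linarith

lemma sum_length : ∑ j, (T.right j - T.left j) = b - a :=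
  T.sum_right_sub_left id

lemma lt (T : Mesh a b) : a < b := by
  rw [← sub_pos, ← T.sum_length]
  exact Finset.sum_pos (fun j _ => sub_pos.mpr (T.left_lt_right j)) Finset.univ_nonempty

lemma sum_integral {f : ℝ → ℝ} (hf : Continuous f) :
    ∑ j, ∫ x in (T.left j)..(T.right j), f x = ∫ x in a..b, f x := by
  have h := T.sum_right_sub_left fun y => ∫ x in a..y, f x
  simpa only [intervalIntegral.integral_interval_sub_left (hf.intervalIntegrable _ _)
    (hf.intervalIntegrable _ _), intervalIntegral.integral_same, sub_zero] using h

lemma sum_integral_le {f : Fin T.N → ℝ → ℝ} (hf : ∀ j, Continuous (f j)) {E : ℝ}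
    (hE : ∀ j, ∀ x ∈ Icc (T.left j) (T.right j), f j x ≤ E) :
    ∑ j, ∫ x in (T.left j)..(T.right j), f j x ≤ (b - a) * E := by
  rw [← T.sum_length, Finset.sum_mul]
  refine Finset.sum_le_sum fun j _ => ?_
  simpa using intervalIntegral.integral_mono_on (μ := MeasureTheory.volume)
    (T.left_lt_right j).le ((hf j).intervalIntegrable _ _)
    (intervalIntegrable_const (c := E)) (hE j)

lemma sum_add_one (f : Fin T.N → ℝ) : ∑ j, f (j + 1) = ∑ j, f j :=
  Equiv.sum_comp (Equiv.addRight (1 : Fin T.N)) f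

lemma apply_left_add_one {f : ℝ → ℝ} (hf : f a = f b) (j : Fin T.N) :
    f (T.left (j + 1)) = f (T.right j) :=
  apply_castSucc_add_one (F := f ∘ T.x) (by simp [T.x_first, T.x_last, hf]) j

end Mesh

namespace Vh

variable {a b : ℝ} {T : Mesh a b} {k : ℕ}

/-! ### The `L²` projection on each cell -/

lemma poly_mem_degreeLT (v : Vh T k) (j : Fin T.N) : v.poly j ∈ ℝ[X]_(k + 1) := (v j).2

@[simp] lemma poly_sub (v w : Vh T k) (j : Fin T.N) : (v - w).poly j = v.poly j - w.poly j := rfl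

/-- The element of `V_h` that is equal to `p` on the cell `I_j` and vanishes on the other cells. -/
def single (j : Fin T.N) (p : ℝ[X]_(k + 1)) : Vh T k := Pi.single j p

lemma sum_integral_mul_single (w : Fin T.N → ℝ → ℝ) (j : Fin T.N) (p : ℝ[X]_(k + 1)) :
    ∑ i, ∫ x in (T.left i)..(T.right i), w i x * ((single j p : Vh T k).poly i).eval x =
      ∫ x in (T.left j)..(T.right j), w j x * (p : ℝ[X]).eval x := by
  rw [Finset.sum_eq_single j]
  · simp [poly, single]
  · intro i _ hij
    simp [poly, single, hij]
  · simp

lemma integral_proj0_mul {f : ℝ → ℝ} (hf : Continuous f) (j : Fin T.N) {p : ℝ[X]}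
    (hp : p ∈ ℝ[X]_(k + 1)) :
    ∫ x in (T.left j)..(T.right j), ((proj0 T k f).poly j).eval x * p.eval x =
      ∫ x in (T.left j)..(T.right j), f x * p.eval x := by
  have h := inner_proj0 hf (single j ⟨p, hp⟩ : Vh T k)
  rwa [inner_def, pairing, sum_integral_mul_single (fun i x => ((proj0 T k f).poly i).eval x),
    sum_integral_mul_single fun _ => f] at h

/-- The `L²` projection onto `V_h` of the function that is equal to `w j` on the cell `I_j`. As the
functions of `V_h` may jump at the interfaces, `Π₀` acts on each cell separately. -/
def cellwiseProj (k : ℕ) (w : Fin T.N → ℝ → ℝ) : Vh T k := fun j => proj0 T k (w j) j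

lemma exists_abs_sub_cellwiseProj_le (k : ℕ) : ∃ C : ℝ, 0 ≤ C ∧ ∀ (a b : ℝ) (T : Mesh a b)
    (w : Fin T.N → ℝ → ℝ) (j : Fin T.N), Continuous (w j) → ∀ Q ∈ ℝ[X]_(k + 1), ∀ W : ℝ,
    (∀ x ∈ Icc (T.left j) (T.right j), |w j x - Q.eval x| ≤ W) →
    ∀ x ∈ Icc (T.left j) (T.right j), |w j x - ((cellwiseProj k w).poly j).eval x| ≤ C * W := by
  obtain ⟨S, hS, hstable⟩ := exists_abs_eval_le_of_integral_sq_eq k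
  refine ⟨1 + S, by linarith, fun a b T w j hw Q hQ W hW x hx => ?_⟩
  set P := (cellwiseProj k w).poly j - Q with hP
  have hPmem : P ∈ ℝ[X]_(k + 1) := Submodule.sub_mem _ (poly_mem_degreeLT _ j) hQ
  have hmoments : ∫ y in (T.left j)..(T.right j), P.eval y * P.eval y =
      ∫ y in (T.left j)..(T.right j), (w j y - Q.eval y) * P.eval y := by
    have hcell : ∫ y in (T.left j)..(T.right j), ((cellwiseProj k w).poly j).eval y * P.eval y =
        ∫ y in (T.left j)..(T.right j), w j y * P.eval y := integral_proj0_mul hw j hPmem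
    have hsub (y : ℝ) : P.eval y * P.eval y =
        ((cellwiseProj k w).poly j).eval y * P.eval y - Q.eval y * P.eval y := by
      rw [← sub_mul, hP, Polynomial.eval_sub]
    simp only [hsub, sub_mul (w j _)]
    rw [intervalIntegral.integral_sub (Continuous.intervalIntegrable (by fun_prop) _ _)
      (Continuous.intervalIntegrable (by fun_prop) _ _), hcell,
      intervalIntegral.integral_sub (Continuous.intervalIntegrable (by fun_prop) _ _)
      (Continuous.intervalIntegrable (by fun_prop) _ _)]
  have hPx := hstable _ _ (T.left_lt_right j) P hPmem _ (by fun_prop) hmoments W hW x hx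
  calc |w j x - ((cellwiseProj k w).poly j).eval x| = |w j x - Q.eval x - P.eval x| := by
        rw [hP, Polynomial.eval_sub]
        ring_nf
    _ ≤ |w j x - Q.eval x| + |P.eval x| := abs_sub _ _
    _ ≤ W + S * W := add_le_add (hW x hx) hPx
    _ = (1 + S) * W := by ring

lemma exists_abs_sub_proj0_le (k : ℕ) : ∃ C : ℝ, 0 ≤ C ∧ ∀ (a b : ℝ) (T : Mesh a b) (f : ℝ → ℝ)
    (W : ℝ), ContDiff ℝ (k + 1 : ℕ) f → (∀ x, |iteratedDeriv (k + 1) f x| ≤ W) → ∀ j,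
    ∀ x ∈ Icc (T.left j) (T.right j),
      |f x - ((proj0 T k f).poly j).eval x| ≤ C * (W * T.h ^ (k + 1)) := by
  obtain ⟨C, hC, hproj⟩ := exists_abs_sub_cellwiseProj_le k
  refine ⟨C, hC, fun a b T f W hf hW j => ?_⟩
  have hW0 : 0 ≤ W := (abs_nonneg _).trans (hW 0)
  obtain ⟨Q, hQ, hfQ⟩ := exists_polynomial_abs_sub_le hf (T.left_lt_right j) hW
  refine hproj a b T (fun _ => f) j hf.continuous Q hQ _ fun y hy => (hfQ y hy).trans ?_
  have hlength := (sub_pos.mpr (T.left_lt_right j)).le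
  have hh := T.sub_le_h j
  gcongr

/-! ### The generalized Gauss-Radau projection -/

/-- `P` is the generalized Gauss-Radau projection of the function that is equal to `w j` on the cell
`I_j`: it has the same moments of order below `k` on each cell, and its numerical flux at the
interfaces is `w`. -/
structure IsGaussRadau (θ : ℝ) (w : Fin T.N → ℝ → ℝ) (P : Vh T k) : Prop where
  integral_mul_eq : ∀ j, ∀ p ∈ ℝ[X]_k,
    ∫ x in (T.left j)..(T.right j), (P.poly j).eval x * p.eval x =
      ∫ x in (T.left j)..(T.right j), w j x * p.eval x
  flux_eq : ∀ j, P.flux θ j = w j (T.right j)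

lemma abs_ne_abs_one_sub {θ : ℝ} (hθ : θ ≠ 1 / 2) : |θ| ≠ |1 - θ| := by
  intro h
  rcases abs_eq_abs.mp h with h | h
  · exact hθ (by linarith)
  · linarith

/-- Adding multiples of the Legendre polynomials of degree `k` changes the fluxes but no moment of
order below `k`. -/
def addLegendre (v : Vh T k) (c : Fin T.N → ℝ) : Vh T k :=
  fun j => v j + c j • ⟨legendreCell k (T.left j) (T.right j), legendreCell_mem_degreeLT k _ _⟩

lemma poly_addLegendre (v : Vh T k) (c : Fin T.N → ℝ) (j : Fin T.N) :
    (v.addLegendre c).poly j = v.poly j + c j • legendreCell k (T.left j) (T.right j) := rfl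

lemma integral_addLegendre_mul (v : Vh T k) (c : Fin T.N → ℝ) (j : Fin T.N) {p : ℝ[X]}
    (hp : p ∈ ℝ[X]_k) :
    ∫ x in (T.left j)..(T.right j), ((v.addLegendre c).poly j).eval x * p.eval x =
      ∫ x in (T.left j)..(T.right j), (v.poly j).eval x * p.eval x := by
  simp only [poly_addLegendre, Polynomial.eval_add, Polynomial.eval_smul, smul_eq_mul, add_mul,
    mul_assoc]
  rw [intervalIntegral.integral_add (Continuous.intervalIntegrable (by fun_prop) _ _)
    (Continuous.intervalIntegrable (by fun_prop) _ _), intervalIntegral.integral_const_mul,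
    integral_legendreCell_mul_eq_zero (T.left_lt_right j) hp, mul_zero, add_zero]

lemma flux_addLegendre (θ : ℝ) (v : Vh T k) (c : Fin T.N → ℝ) (j : Fin T.N) :
    (v.addLegendre c).flux θ j = v.flux θ j + (θ * c j + (1 - θ) * (-1) ^ k * c (j + 1)) := by
  simp only [flux, traceMinus, tracePlus, poly_addLegendre, Polynomial.eval_add,
    Polynomial.eval_smul, eval_legendreCell_right, eval_legendreCell_left k (T.left_lt_right _),
    smul_eq_mul]
  ring

lemma abs_sub_flux_le (θ : ℝ) {v : Vh T k} {w : Fin T.N → ℝ → ℝ} {E : ℝ}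
    (hmatch : ∀ j, w (j + 1) (T.left (j + 1)) = w j (T.right j))
    (hE : ∀ j, ∀ x ∈ Icc (T.left j) (T.right j), |w j x - (v.poly j).eval x| ≤ E) (j : Fin T.N) :
    |w j (T.right j) - v.flux θ j| ≤ (|θ| + |1 - θ|) * E := by
  calc |w j (T.right j) - v.flux θ j|
      = |θ * (w j (T.right j) - (v.poly j).eval (T.right j)) + (1 - θ) *
        (w (j + 1) (T.left (j + 1)) - (v.poly (j + 1)).eval (T.left (j + 1)))| := by
        simp only [flux, traceMinus, tracePlus, hmatch]
        ring_nf
    _ ≤ |θ| * E + |1 - θ| * E := by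
        refine (abs_add_le _ _).trans ?_
        rw [abs_mul, abs_mul]
        gcongr
        exacts [hE j _ (T.right_mem_cell j), hE (j + 1) _ (T.left_mem_cell (j + 1))]
    _ = (|θ| + |1 - θ|) * E := by ring

lemma exists_isGaussRadau (k : ℕ) {θ : ℝ} (hθ : θ ≠ 1 / 2) : ∃ C : ℝ, 0 ≤ C ∧
    ∀ (a b : ℝ) (T : Mesh a b) (w : Fin T.N → ℝ → ℝ), (∀ j, Continuous (w j)) →
    (∀ j, w (j + 1) (T.left (j + 1)) = w j (T.right j)) → ∀ E : ℝ,
    (∀ j, ∀ x ∈ Icc (T.left j) (T.right j), |w j x - ((cellwiseProj k w).poly j).eval x| ≤ E) →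
    ∃ P : Vh T k, IsGaussRadau θ w P ∧
      ∀ j, ∀ x ∈ Icc (T.left j) (T.right j), |w j x - (P.poly j).eval x| ≤ C * E := by
  obtain ⟨B, hB, hlegendre⟩ := exists_abs_eval_legendreCell_le k
  have hsep : |θ| ≠ |(1 - θ) * (-1) ^ k| := by simpa using abs_ne_abs_one_sub hθ
  set δ := |(|θ| - |(1 - θ) * (-1) ^ k|)|
  have hδ : 0 < δ := abs_pos.mpr (sub_ne_zero.mpr hsep)
  refine ⟨1 + (|θ| + |1 - θ|) / δ * B, by positivity, fun a b T w hw hmatch E hE => ?_⟩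
  have hE0 : 0 ≤ E := (abs_nonneg _).trans (hE 0 _ (T.left_mem_cell 0))
  let π : Vh T k := cellwiseProj k w
  let defect : Fin T.N → ℝ := fun j => w j (T.right j) - π.flux θ j
  have hdefect : ‖defect‖ ≤ (|θ| + |1 - θ|) * E :=
    (pi_norm_le_iff_of_nonneg (by positivity)).mpr fun j => abs_sub_flux_le θ hmatch hE j
  obtain ⟨c, hc, hcnorm⟩ := exists_mul_add_mul_comp_equiv_eq (Equiv.addRight 1) hsep defect
  refine ⟨π.addLegendre c, ⟨fun j p hp => ?_, fun j => ?_⟩, fun j x hx => ?_⟩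
  · rw [integral_addLegendre_mul π c j hp]
    exact integral_proj0_mul (hw j) j (Polynomial.degreeLT_mono k.le_succ hp)
  · have hcj := hc j
    simp only [Equiv.coe_addRight] at hcj
    rw [flux_addLegendre, hcj]
    exact add_sub_cancel _ _
  · have hcj : |c j| ≤ (|θ| + |1 - θ|) * E / δ :=
      (norm_le_pi_norm c j).trans ((le_div_iff₀' hδ).mpr (hcnorm.trans hdefect))
    rw [poly_addLegendre, Polynomial.eval_add, Polynomial.eval_smul, smul_eq_mul, ← sub_sub]
    calc _ ≤ |w j x - (π.poly j).eval x| + |c j| * |(legendreCell k _ _).eval x| := by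
          rw [← abs_mul]
          exact abs_sub _ _
      _ ≤ E + (|θ| + |1 - θ|) * E / δ * B := by
          gcongr
          exacts [hE j x hx, hlegendre _ _ (T.left_lt_right j) x hx]
      _ = (1 + (|θ| + |1 - θ|) / δ * B) * E := by ring

lemma IsGaussRadau.inner_D {θ : ℝ} {w g : Fin T.N → ℝ → ℝ} {P : Vh T k}
    (hP : IsGaussRadau θ w P) (hw : ∀ j x, HasDerivAt (w j) (g j x) x)
    (hg : ∀ j, Continuous (g j)) (hmatch : ∀ j, w (j + 1) (T.left (j + 1)) = w j (T.right j))
    (v : Vh T k) :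
    ⟪D T k θ P, v⟫_ℝ = ∑ j, ∫ x in (T.left j)..(T.right j), g j x * (v.poly j).eval x := by
  have hparts (j : Fin T.N) :
      ∫ x in (T.left j)..(T.right j), (P.poly j).eval x * (v.poly j).derivative.eval x =
        w j (T.right j) * (v.poly j).eval (T.right j) - w j (T.left j) * (v.poly j).eval (T.left j)
          - ∫ x in (T.left j)..(T.right j), g j x * (v.poly j).eval x := by
    rw [hP.integral_mul_eq j _ (derivative_mem_degreeLT (poly_mem_degreeLT v j))]
    exact intervalIntegral.integral_mul_deriv_eq_deriv_mul (fun x _ => hw j x)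
      (fun x _ => (v.poly j).hasDerivAt x) ((hg j).intervalIntegrable _ _)
      (Continuous.intervalIntegrable (by fun_prop) _ _)
  have hshift := T.sum_add_one fun j => w j (T.left j) * (v.poly j).eval (T.left j)
  simp only [hmatch] at hshift
  rw [Vh.inner_D, dgForm]
  simp only [hparts, hP.flux_eq, jump, tracePlus, traceMinus, mul_sub, Finset.sum_sub_distrib]
  rw [hshift]
  ring

end Vh

namespace Vh

variable {a b : ℝ} {T : Mesh a b} {k : ℕ}

/-! ### The norm of `V_h` -/

lemma norm_sq_eq (v : Vh T k) :
    ‖v‖ ^ 2 = ∑ j, ∫ x in (T.left j)..(T.right j), (v.poly j).eval x ^ 2 := by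
  rw [← real_inner_self_eq_norm_sq, inner_def]
  simp only [sq]

lemma norm_le_of_abs_le (v : Vh T k) {E : ℝ}
    (hE : ∀ j, ∀ x ∈ Icc (T.left j) (T.right j), |(v.poly j).eval x| ≤ E) :
    ‖v‖ ≤ √(b - a) * E := by
  have hE0 : 0 ≤ E := (abs_nonneg _).trans (hE 0 _ (T.left_mem_cell 0))
  refine abs_le_of_sq_le_sq' ?_ (by positivity) |>.2
  rw [norm_sq_eq, mul_pow, Real.sq_sqrt (sub_pos.mpr T.lt).le]
  exact T.sum_integral_le (f := fun j x => (v.poly j).eval x ^ 2) (fun j => by fun_prop)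
    fun j x hx => sq_le_sq' (abs_le.mp (hE j x hx)).1 (abs_le.mp (hE j x hx)).2

lemma two_mul_sum_integral_abs_le (v : Vh T k) :
    2 * ∑ j, ∫ x in (T.left j)..(T.right j), |(v.poly j).eval x| ≤ (b - a + 1) * ‖v‖ := by
  have hyoung := T.sum_integral_le
    (f := fun j x => 2 * ‖v‖ * |(v.poly j).eval x| - (v.poly j).eval x ^ 2) (E := ‖v‖ ^ 2)
    (fun j => by fun_prop) fun j x _ => by
      nlinarith [sq_nonneg (‖v‖ - |(v.poly j).eval x|), sq_abs ((v.poly j).eval x)]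
  have hsplit (j : Fin T.N) : ∫ x in (T.left j)..(T.right j),
      (2 * ‖v‖ * |(v.poly j).eval x| - (v.poly j).eval x ^ 2) =
      2 * ‖v‖ * (∫ x in (T.left j)..(T.right j), |(v.poly j).eval x|) -
        ∫ x in (T.left j)..(T.right j), (v.poly j).eval x ^ 2 := by
    rw [intervalIntegral.integral_sub (Continuous.intervalIntegrable (by fun_prop) _ _)
      (Continuous.intervalIntegrable (by fun_prop) _ _), intervalIntegral.integral_const_mul]
  simp only [hsplit, Finset.sum_sub_distrib, ← Finset.mul_sum, ← norm_sq_eq] at hyoung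
  rcases (norm_nonneg v).eq_or_lt with hv | hv
  · have hv0 : v = 0 := norm_eq_zero.mp hv.symm
    simp [hv0]
  · refine le_of_mul_le_mul_left ?_ hv
    linarith

lemma l2Error_le {w : ℝ → ℝ} (hw : Continuous w) (v' v : Vh T k) {E : ℝ}
    (hE : ∀ j, ∀ x ∈ Icc (T.left j) (T.right j), |w x - (v'.poly j).eval x| ≤ E) :
    l2Error w v ≤ 2 * (√(b - a) * E + ‖v' - v‖) := by
  have hE0 : 0 ≤ E := (abs_nonneg _).trans (hE 0 _ (T.left_mem_cell 0))
  have hpointwise := T.sum_integral_le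
    (f := fun j x => (w x - (v.poly j).eval x) ^ 2 - 2 * ((v' - v).poly j).eval x ^ 2)
    (E := 2 * E ^ 2) (fun j => by fun_prop) fun j x hx => by
      have hsq := sq_le_sq' (abs_le.mp (hE j x hx)).1 (abs_le.mp (hE j x hx)).2
      rw [poly_sub, Polynomial.eval_sub]
      nlinarith [sq_nonneg ((w x - (v'.poly j).eval x) - ((v'.poly j).eval x - (v.poly j).eval x))]
  have hsplit (j : Fin T.N) : ∫ x in (T.left j)..(T.right j),
      ((w x - (v.poly j).eval x) ^ 2 - 2 * ((v' - v).poly j).eval x ^ 2) =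
      (∫ x in (T.left j)..(T.right j), (w x - (v.poly j).eval x) ^ 2) -
        2 * ∫ x in (T.left j)..(T.right j), ((v' - v).poly j).eval x ^ 2 := by
    rw [intervalIntegral.integral_sub (Continuous.intervalIntegrable (by fun_prop) _ _)
      (Continuous.intervalIntegrable (by fun_prop) _ _), intervalIntegral.integral_const_mul]
  simp only [hsplit, Finset.sum_sub_distrib, ← Finset.mul_sum, ← norm_sq_eq] at hpointwise
  have hlength : (√(b - a) * E) ^ 2 = (b - a) * E ^ 2 := by
    rw [mul_pow, Real.sq_sqrt (sub_pos.mpr T.lt).le]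
  have hcross : 0 ≤ √(b - a) * E * ‖v' - v‖ := by positivity
  refine Real.sqrt_le_iff.mpr ⟨by positivity, ?_⟩
  nlinarith [sq_nonneg (√(b - a) * E), sq_nonneg ‖v' - v‖]

lemma norm_proj0_le {f : ℝ → ℝ} (hf : Continuous f) {W : ℝ} (hW : ∀ x, |f x| ≤ W) :
    ‖proj0 T k f‖ ≤ √(b - a) * W := by
  have hW0 : 0 ≤ W := (abs_nonneg _).trans (hW 0)
  set v := proj0 T k f with hv
  have hyoung := T.sum_integral_le
    (f := fun j x => 2 * (f x * (v.poly j).eval x) - (v.poly j).eval x ^ 2) (E := W ^ 2)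
    (fun j => by fun_prop) fun j x _ => by
      nlinarith [sq_nonneg (f x - (v.poly j).eval x),
        sq_le_sq' (abs_le.mp (hW x)).1 (abs_le.mp (hW x)).2]
  have hsplit (j : Fin T.N) : ∫ x in (T.left j)..(T.right j),
      (2 * (f x * (v.poly j).eval x) - (v.poly j).eval x ^ 2) =
      2 * (∫ x in (T.left j)..(T.right j), f x * (v.poly j).eval x) -
        ∫ x in (T.left j)..(T.right j), (v.poly j).eval x ^ 2 := by
    rw [intervalIntegral.integral_sub (Continuous.intervalIntegrable (by fun_prop) _ _)
      (Continuous.intervalIntegrable (by fun_prop) _ _), intervalIntegral.integral_const_mul]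
  have hpairing : pairing f v = ‖v‖ ^ 2 := by
    rw [← inner_proj0 hf, ← hv, real_inner_self_eq_norm_sq]
  simp only [hsplit, Finset.sum_sub_distrib, ← Finset.mul_sum, ← norm_sq_eq] at hyoung
  rw [← pairing, hpairing] at hyoung
  refine abs_le_of_sq_le_sq' ?_ (by positivity) |>.2
  rw [mul_pow, Real.sq_sqrt (sub_pos.mpr T.lt).le]
  linarith

/-! ### Constants and mean values -/

@[simp] lemma poly_const (c : ℝ) (j : Fin T.N) : (const c : Vh T k).poly j = Polynomial.C c := rfl

lemma const_eq_smul (c : ℝ) : (const c : Vh T k) = c • const 1 :=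
  ext_poly fun j => by
    rw [poly_smul, poly_const, poly_const, Polynomial.smul_C, smul_eq_mul, mul_one]

lemma inner_const_one (v : Vh T k) :
    ⟪v, const 1⟫_ℝ = ∑ j, ∫ x in (T.left j)..(T.right j), (v.poly j).eval x := by
  simp [inner_def]

lemma norm_sq_const_one : ‖(const 1 : Vh T k)‖ ^ 2 = b - a := by
  rw [norm_sq_eq, ← T.sum_length]
  simp

lemma norm_const_one : ‖(const 1 : Vh T k)‖ = √(b - a) := by
  rw [← norm_sq_const_one (T := T) (k := k), Real.sqrt_sq (norm_nonneg _)]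

lemma inner_proj0_const_one {f : ℝ → ℝ} (hf : Continuous f) :
    ⟪proj0 T k f, const 1⟫_ℝ = ∫ x in a..b, f x := by
  rw [inner_proj0 hf, pairing, ← T.sum_integral hf]
  simp

/-- `Z_h` as a subspace: the orthogonal complement of the constants. -/
def zeroMean (T : Mesh a b) (k : ℕ) : Submodule ℝ (Vh T k) := (ℝ ∙ (const 1 : Vh T k))ᗮ

lemma mem_zeroMean {v : Vh T k} : v ∈ zeroMean T k ↔ ⟪v, const 1⟫_ℝ = 0 :=
  Submodule.mem_orthogonal_singleton_iff_inner_left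

lemma proj0_mem_zeroMean {f : ℝ → ℝ} (hf : Continuous f) (h0 : ∫ x in a..b, f x = 0) :
    proj0 T k f ∈ zeroMean T k := by
  rw [mem_zeroMean, inner_proj0_const_one hf, h0]

/-- The part of `v` with zero mean, that is, its orthogonal projection onto `Z_h`. -/
def centered : Vh T k →L[ℝ] Vh T k := (zeroMean T k).starProjection

lemma centered_mem (v : Vh T k) : centered v ∈ zeroMean T k :=
  Submodule.starProjection_apply_mem _ v

lemma centered_eq_self {v : Vh T k} (hv : v ∈ zeroMean T k) : centered v = v :=
  Submodule.starProjection_eq_self_iff.mpr hv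

lemma norm_centered_le (v : Vh T k) : ‖centered v‖ ≤ ‖v‖ :=
  Submodule.norm_starProjection_apply_le _ v

lemma centered_add_const (v : Vh T k) : centered v + const (⟪v, const 1⟫_ℝ / (b - a)) = v := by
  change (ℝ ∙ (const 1 : Vh T k))ᗮ.starProjection v + _ = v
  rw [Submodule.starProjection_orthogonal_val, Submodule.starProjection_singleton,
    const_eq_smul (⟪v, const 1⟫_ℝ / (b - a))]
  simp [norm_sq_const_one, real_inner_comm]

end Vh

namespace Vh

variable {a b : ℝ} {T : Mesh a b} {k : ℕ}

/-! ### The discontinuous Galerkin operators -/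

lemma dgForm_skew (θ : ℝ) (w v : Vh T k) : dgForm θ w v = -dgForm (1 - θ) v w := by
  have hparts (j : Fin T.N) :
      ∫ x in (T.left j)..(T.right j), (w.poly j).eval x * (v.poly j).derivative.eval x =
        (w.poly j).eval (T.right j) * (v.poly j).eval (T.right j) -
          (w.poly j).eval (T.left j) * (v.poly j).eval (T.left j) -
          ∫ x in (T.left j)..(T.right j), (v.poly j).eval x * (w.poly j).derivative.eval x := by
    simp only [mul_comm ((v.poly j).eval _) ((w.poly j).derivative.eval _)]
    exact intervalIntegral.integral_mul_deriv_eq_deriv_mul (fun x _ => (w.poly j).hasDerivAt x)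
      (fun x _ => (v.poly j).hasDerivAt x) (Continuous.intervalIntegrable (by fun_prop) _ _)
      (Continuous.intervalIntegrable (by fun_prop) _ _)
  have hflux (j : Fin T.N) : w.flux θ j * v.jump j + v.flux (1 - θ) j * w.jump j =
      (w.poly (j + 1)).eval (T.left (j + 1)) * (v.poly (j + 1)).eval (T.left (j + 1)) -
        (w.poly j).eval (T.right j) * (v.poly j).eval (T.right j) := by
    simp only [flux, jump, traceMinus, tracePlus]
    ring
  have hfluxes := Finset.sum_congr rfl fun j (_ : j ∈ Finset.univ) => hflux j
  rw [Finset.sum_add_distrib, Finset.sum_sub_distrib,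
    T.sum_add_one fun j => (w.poly j).eval (T.left j) * (v.poly j).eval (T.left j)] at hfluxes
  simp only [dgForm, hparts, Finset.sum_sub_distrib]
  linarith

lemma inner_D_skew (θ : ℝ) (w v : Vh T k) : ⟪D T k θ w, v⟫_ℝ = -⟪w, D T k (1 - θ) v⟫_ℝ := by
  rw [inner_D, dgForm_skew, ← inner_D, real_inner_comm]

lemma adjoint_D (θ : ℝ) : LinearMap.adjoint (D T k θ) = -D T k (1 - θ) := by
  refine ((LinearMap.eq_adjoint_iff _ _).mpr fun v w => ?_).symm
  rw [LinearMap.neg_apply, inner_neg_left, inner_D_skew, neg_neg, sub_sub_cancel]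

lemma dgForm_const_right (θ c : ℝ) (w : Vh T k) : dgForm θ w (const c) = 0 := by
  simp [dgForm, jump, tracePlus, traceMinus]

@[simp] lemma D_const (θ c : ℝ) : D T k θ (const c) = 0 :=
  ext_inner_right ℝ fun v => by
    rw [inner_D, dgForm_skew, dgForm_const_right, inner_zero_left, neg_zero]

lemma D_mem_zeroMean (θ : ℝ) (w : Vh T k) : D T k θ w ∈ zeroMean T k := by
  rw [mem_zeroMean, inner_D, dgForm_const_right]

lemma D_centered (θ : ℝ) (v : Vh T k) : D T k θ (centered v) = D T k θ v := by
  conv_rhs => rw [← centered_add_const v, map_add, D_const, add_zero]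

/-! ### The discrete Poincaré inequality -/

lemma exists_continuous_primitive {v : Vh T k} (hv : v ∈ zeroMean T k) :
    ∃ ψ : Fin T.N → ℝ → ℝ, (∀ j x, HasDerivAt (ψ j) ((v.poly j).eval x) x) ∧
      (∀ j, ψ (j + 1) (T.left (j + 1)) = ψ j (T.right j)) ∧
      ∀ j, ∀ x ∈ Icc (T.left j) (T.right j), |ψ j x| ≤ (b - a + 1) * ‖v‖ := by
  have hcont (j : Fin T.N) : Continuous fun x => (v.poly j).eval x := (v.poly j).continuous
  rw [mem_zeroMean, inner_const_one] at hv
  obtain ⟨S, hS, hSle⟩ := exists_cyclic_primitive hv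
  refine ⟨fun j x => S j + ∫ y in (T.left j)..x, (v.poly j).eval y, fun j x => ?_, fun j => ?_,
    fun j x hx => ?_⟩
  · exact (intervalIntegral.integral_hasDerivAt_right ((hcont j).intervalIntegrable _ _)
      ((hcont j).stronglyMeasurableAtFilter _ _) (hcont j).continuousAt).const_add _
  · simp only [intervalIntegral.integral_same, add_zero, hS]
  · have hSj : |S j| ≤ ∑ j, ∫ x in (T.left j)..(T.right j), |(v.poly j).eval x| :=
      (hSle j).trans (Finset.sum_le_sum fun i _ =>
        intervalIntegral.abs_integral_le_integral_abs (T.left_lt_right i).le)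
    have hcell : |∫ y in (T.left j)..x, (v.poly j).eval y| ≤
        ∑ j, ∫ x in (T.left j)..(T.right j), |(v.poly j).eval x| :=
      calc _ ≤ ∫ y in (T.left j)..x, |(v.poly j).eval y| :=
            intervalIntegral.abs_integral_le_integral_abs hx.1
        _ ≤ ∫ y in (T.left j)..(T.right j), |(v.poly j).eval y| :=
            intervalIntegral.integral_mono_interval le_rfl hx.1 hx.2
              (Filter.Eventually.of_forall fun _ => abs_nonneg _)
              ((hcont j).abs.intervalIntegrable _ _)
        _ ≤ _ := Finset.single_le_sum
            (f := fun j => ∫ x in (T.left j)..(T.right j), |(v.poly j).eval x|)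
            (fun i _ => intervalIntegral.integral_nonneg (T.left_lt_right i).le
              fun _ _ => abs_nonneg _) (Finset.mem_univ j)
    linarith [abs_add_le (S j) (∫ y in (T.left j)..x, (v.poly j).eval y),
      two_mul_sum_integral_abs_le v]

lemma exists_D_eq_norm_le (a b : ℝ) (k : ℕ) {θ : ℝ} (hθ : θ ≠ 1 / 2) : ∃ C : ℝ,
    ∀ (T : Mesh a b) (v : Vh T k), v ∈ zeroMean T k →
    ∃ P : Vh T k, D T k θ P = v ∧ ‖P‖ ≤ C * ‖v‖ := by
  obtain ⟨C, _, hradau⟩ := exists_isGaussRadau k hθ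
  obtain ⟨S, _, hproj⟩ := exists_abs_sub_cellwiseProj_le k
  refine ⟨√(b - a) * ((1 + C * S) * (b - a + 1)), fun T v hv => ?_⟩
  obtain ⟨ψ, hderiv, hmatch, hψ⟩ := exists_continuous_primitive hv
  have hcont (j : Fin T.N) : Continuous (ψ j) :=
    continuous_iff_continuousAt.mpr fun x => (hderiv j x).continuousAt
  obtain ⟨P, hP, hPψ⟩ := hradau a b T ψ hcont hmatch _ fun j =>
    hproj a b T ψ j (hcont j) 0 (Submodule.zero_mem _) _ fun x hx => by simpa using hψ j x hx
  refine ⟨P, ext_inner_right ℝ fun w => ?_, ?_⟩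
  · rw [hP.inner_D hderiv (fun j => (v.poly j).continuous) hmatch, inner_def]
  · rw [mul_assoc, mul_assoc]
    refine norm_le_of_abs_le P fun j x hx => ?_
    linarith [abs_sub_abs_le_abs_sub ((P.poly j).eval x) (ψ j x), hψ j x hx, hPψ j x hx,
      abs_sub_comm (ψ j x) ((P.poly j).eval x)]

lemma exists_norm_le_norm_D (a b : ℝ) (k : ℕ) {θ : ℝ} (hθ : θ ≠ 1 / 2) : ∃ C : ℝ, 0 ≤ C ∧
    ∀ (T : Mesh a b) (v : Vh T k), v ∈ zeroMean T k → ‖v‖ ≤ C * ‖D T k θ v‖ := by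
  obtain ⟨C, hC⟩ := exists_D_eq_norm_le a b k (θ := 1 - θ) fun h => hθ (by linarith)
  refine ⟨max C 0, le_max_right _ _, fun T v hv => ?_⟩
  obtain ⟨P, hP, hPv⟩ := hC T v hv
  rcases (norm_nonneg v).eq_or_lt with h0 | hpos
  · rw [← h0]
    positivity
  · refine le_of_mul_le_mul_left ?_ hpos
    calc ‖v‖ * ‖v‖ = ⟪v, D T k (1 - θ) P⟫_ℝ := by rw [hP, real_inner_self_eq_norm_mul_norm]
      _ = ⟪-D T k θ v, P⟫_ℝ := by rw [inner_neg_left, inner_D_skew, neg_neg]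
      _ ≤ ‖D T k θ v‖ * ‖P‖ := by simpa using real_inner_le_norm (-D T k θ v) P
      _ ≤ ‖D T k θ v‖ * (max C 0 * ‖v‖) := by
        gcongr
        exact hPv.trans (by gcongr; exact le_max_left _ _)
      _ = ‖v‖ * (max C 0 * ‖D T k θ v‖) := by ring

lemma Dinv_spec {θ : ℝ} (hθ : θ ≠ 1 / 2) {y : Vh T k} (hy : y ∈ zeroMean T k) :
    Dinv θ y ∈ zeroMean T k ∧ D T k θ (Dinv θ y) = y := by
  have hZh (v : Vh T k) : v ∈ Zh T k ↔ v ∈ zeroMean T k := mem_zeroMean.symm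
  obtain ⟨C, _, hC⟩ := exists_norm_le_norm_D a b k hθ
  let A : zeroMean T k →ₗ[ℝ] zeroMean T k := (D T k θ).restrict fun v _ => D_mem_zeroMean θ v
  have hinj : Function.Injective A := (injective_iff_map_eq_zero A).mpr fun v hv => by
    have hDv : D T k θ v = 0 := congrArg Subtype.val hv
    have hnorm := hC T v v.2
    rw [hDv, norm_zero, mul_zero] at hnorm
    exact Subtype.ext (norm_le_zero_iff.mp hnorm)
  obtain ⟨v, hv⟩ := LinearMap.injective_iff_surjective.mp hinj ⟨y, hy⟩
  have hex : ∃ v ∈ Zh T k, D T k θ v = y := ⟨v, (hZh v).mpr v.2, congrArg Subtype.val hv⟩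
  exact ⟨(hZh _).mp (Function.invFunOn_mem hex), Function.invFunOn_eq hex⟩

end Vh

/-! ### Smooth periodic functions -/

lemma iteratedDeriv_iteratedDeriv (i j : ℕ) (f : ℝ → ℝ) :
    iteratedDeriv i (iteratedDeriv j f) = iteratedDeriv (i + j) f := by
  simp only [iteratedDeriv_eq_iterate, Function.iterate_add_apply]

lemma contDiff_iteratedDeriv {f : ℝ → ℝ} {n i j : ℕ} (hf : ContDiff ℝ n f) (hij : i + j ≤ n) :
    ContDiff ℝ i (iteratedDeriv j f) := by
  rw [iteratedDeriv_eq_iterate]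
  exact (hf.of_le (by exact_mod_cast hij)).iterate_deriv' i j

lemma periodic_iteratedDeriv {f : ℝ → ℝ} {c : ℝ} (hf : Function.Periodic f c) (n : ℕ) :
    Function.Periodic (iteratedDeriv n f) c := fun x => by
  rw [← congrFun (iteratedDeriv_comp_add_const n f c) x, funext hf]

/-- `f` is `(b - a)`-periodic and of class `C^n`, and its derivatives up to order `n` are bounded
by `W`. -/
structure BoundedSmooth (a b : ℝ) (n : ℕ) (W : ℝ) (f : ℝ → ℝ) : Prop where
  contDiff : ContDiff ℝ n f
  periodic : Function.Periodic f (b - a)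
  bound : ∀ i ≤ n, ∀ x, |iteratedDeriv i f x| ≤ W

namespace BoundedSmooth

variable {a b W : ℝ} {m n : ℕ} {f : ℝ → ℝ}

lemma nonneg (hf : BoundedSmooth a b n W f) : 0 ≤ W :=
  (abs_nonneg _).trans (hf.bound 0 n.zero_le 0)

lemma continuous (hf : BoundedSmooth a b n W f) : Continuous f := hf.contDiff.continuous

lemma of_le (hf : BoundedSmooth a b n W f) (hmn : m ≤ n) : BoundedSmooth a b m W f where
  contDiff := hf.contDiff.of_le (by exact_mod_cast hmn)
  periodic := hf.periodic
  bound i hi := hf.bound i (hi.trans hmn)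

lemma iterDeriv (hf : BoundedSmooth a b n W f) {i : ℕ} (him : m + i ≤ n) :
    BoundedSmooth a b m W (iteratedDeriv i f) where
  contDiff := contDiff_iteratedDeriv hf.contDiff him
  periodic := periodic_iteratedDeriv hf.periodic i
  bound l hl x := by
    rw [iteratedDeriv_iteratedDeriv]
    exact hf.bound _ (by lia) x

lemma apply_eq (hf : BoundedSmooth a b n W f) : f a = f b := by
  rw [← hf.periodic a, add_sub_cancel]

lemma hasDerivAt (hf : BoundedSmooth a b (n + 1) W f) (x : ℝ) : HasDerivAt f (deriv f x) x :=
  (hf.contDiff.differentiable (by simp)).differentiableAt.hasDerivAt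

lemma continuous_deriv (hf : BoundedSmooth a b (n + 1) W f) : Continuous (deriv f) :=
  hf.contDiff.continuous_deriv (by simp)

lemma integral_iteratedDeriv (hf : BoundedSmooth a b n W f) {i : ℕ} (hi : i ≠ 0) (hin : i ≤ n) :
    ∫ x in a..b, iteratedDeriv i f x = 0 := by
  obtain ⟨i, rfl⟩ := Nat.exists_eq_succ_of_ne_zero hi
  have hg : BoundedSmooth a b (0 + 1) W (iteratedDeriv i f) := hf.iterDeriv (by lia)
  rw [iteratedDeriv_succ, intervalIntegral.integral_eq_sub_of_hasDerivAt
    (fun x _ => hg.hasDerivAt x) (hg.continuous_deriv.intervalIntegrable _ _), hg.apply_eq,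
    sub_self]

end BoundedSmooth

namespace Vh

variable {a b : ℝ} {T : Mesh a b} {k : ℕ}

/-! ### Linearity of the `L²` projection -/

lemma pairing_sub_sum {ι : Type*} (s : Finset ι) {f : ℝ → ℝ} {g : ι → ℝ → ℝ} (c : ι → ℝ)
    (hf : Continuous f) (hg : ∀ i ∈ s, Continuous (g i)) (v : Vh T k) :
    pairing (fun x => f x - ∑ i ∈ s, c i * g i x) v =
      pairing f v - ∑ i ∈ s, c i * pairing (g i) v := by
  have hcont : ∀ i ∈ s, ∀ j, Continuous fun x => c i * (g i x * (v.poly j).eval x) :=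
    fun i hi j => by have := hg i hi; fun_prop
  simp only [pairing, Finset.mul_sum]
  rw [Finset.sum_comm, ← Finset.sum_sub_distrib]
  refine Finset.sum_congr rfl fun j _ => ?_
  simp only [sub_mul, Finset.sum_mul, mul_assoc]
  rw [intervalIntegral.integral_sub (Continuous.intervalIntegrable (by fun_prop) _ _)
    ((continuous_finsetSum s fun i hi => hcont i hi j).intervalIntegrable _ _),
    intervalIntegral.integral_finsetSum fun i hi => (hcont i hi j).intervalIntegrable _ _]
  simp only [intervalIntegral.integral_const_mul]

lemma proj0_sub_sum {ι : Type*} (s : Finset ι) {f : ℝ → ℝ} {g : ι → ℝ → ℝ} (c : ι → ℝ)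
    (hf : Continuous f) (hg : ∀ i ∈ s, Continuous (g i)) :
    proj0 T k (fun x => f x - ∑ i ∈ s, c i * g i x) =
      proj0 T k f - ∑ i ∈ s, c i • proj0 T k (g i) := by
  have hcont : Continuous fun x => f x - ∑ i ∈ s, c i * g i x :=
    hf.sub (continuous_finsetSum s fun i hi => continuous_const.mul (hg i hi))
  refine ext_inner_right ℝ fun v => ?_
  rw [inner_proj0 hcont, pairing_sub_sum s c hf hg, inner_sub_left, inner_proj0 hf, sum_inner]
  refine congrArg _ (Finset.sum_congr rfl fun i hi => ?_)
  rw [real_inner_smul_left, inner_proj0 (hg i hi)]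

lemma proj0_const_mul {f : ℝ → ℝ} (hf : Continuous f) (c : ℝ) :
    proj0 T k (fun x => c * f x) = c • proj0 T k f := by
  refine ext_inner_right ℝ fun v => ?_
  rw [inner_proj0 (hf.const_mul c), real_inner_smul_left, inner_proj0 hf, pairing, pairing,
    Finset.mul_sum]
  simp only [mul_assoc, intervalIntegral.integral_const_mul]

/-! ### Approximation by the inverse operators -/

lemma exists_D_eq_proj0_deriv (a b : ℝ) (k : ℕ) {θ : ℝ} (hθ : θ ≠ 1 / 2) : ∃ C : ℝ, 0 ≤ C ∧
    ∀ (T : Mesh a b) (F : ℝ → ℝ) (W : ℝ), BoundedSmooth a b (k + 1) W F →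
    ∃ P : Vh T k, D T k θ P = proj0 T k (deriv F) ∧
      ‖P - proj0 T k F‖ ≤ C * (W * T.h ^ (k + 1)) := by
  obtain ⟨C₁, hC₁, hradau⟩ := exists_isGaussRadau k hθ
  obtain ⟨C₂, hC₂, hproj⟩ := exists_abs_sub_proj0_le k
  refine ⟨√(b - a) * ((C₁ + 1) * C₂), by positivity, fun T F W hF => ?_⟩
  have hmatch (j : Fin T.N) := T.apply_left_add_one hF.apply_eq j
  have hFproj (j : Fin T.N) := hproj a b T F W hF.contDiff (hF.bound _ le_rfl) j
  obtain ⟨P, hP, hFP⟩ := hradau a b T (fun _ => F) (fun _ => hF.continuous) hmatch _ hFproj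
  refine ⟨P, ext_inner_right ℝ fun v => ?_, ?_⟩
  · rw [hP.inner_D (fun _ => hF.hasDerivAt) (fun _ => hF.continuous_deriv) hmatch,
      inner_proj0 hF.continuous_deriv, pairing]
  · rw [mul_assoc]
    refine norm_le_of_abs_le _ fun j x hx => ?_
    rw [poly_sub, Polynomial.eval_sub]
    linarith [abs_sub_le ((P.poly j).eval x) (F x) (((proj0 T k F).poly j).eval x),
      abs_sub_comm (F x) ((P.poly j).eval x), hFP j x hx, hFproj j x hx]

lemma exists_norm_Dinv_sub_le (a b : ℝ) (k : ℕ) {θ : ℝ} (hθ : θ ≠ 1 / 2) : ∃ C : ℝ, 0 ≤ C ∧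
    ∀ (T : Mesh a b) (F : ℝ → ℝ) (W : ℝ), BoundedSmooth a b (k + 1) W F → ∀ y ∈ zeroMean T k,
    ‖Dinv θ y - centered (proj0 T k F)‖ ≤
      C * (‖y - proj0 T k (deriv F)‖ + W * T.h ^ (k + 1)) := by
  obtain ⟨C₁, hC₁, hpoincare⟩ := exists_norm_le_norm_D a b k hθ
  obtain ⟨C₂, hC₂, hproj⟩ := exists_D_eq_proj0_deriv a b k hθ
  refine ⟨C₁ + C₂, by positivity, fun T F W hF y hy => ?_⟩
  obtain ⟨P, hDP, hP⟩ := hproj T F W hF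
  obtain ⟨hmem, hDinv⟩ := Dinv_spec hθ hy
  have hstable : ‖Dinv θ y - centered P‖ ≤ C₁ * ‖y - proj0 T k (deriv F)‖ := by
    have h := hpoincare T _ (Submodule.sub_mem _ hmem (centered_mem P))
    rwa [map_sub, hDinv, D_centered, hDP] at h
  have happrox : ‖centered P - centered (proj0 T k F)‖ ≤ C₂ * (W * T.h ^ (k + 1)) := by
    rw [← map_sub]
    exact (norm_centered_le _).trans hP
  have hWh : 0 ≤ W * T.h ^ (k + 1) := mul_nonneg hF.nonneg (pow_nonneg T.h_pos.le _)
  have hcross₁ := mul_nonneg hC₁ hWh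
  have hcross₂ := mul_nonneg hC₂ (norm_nonneg (y - proj0 T k (deriv F)))
  linarith [norm_sub_le_norm_sub_add_norm_sub (Dinv θ y) (centered P) (centered (proj0 T k F))]

/-! ### Products of discontinuous Galerkin operators -/

/-- The product `D_{h,t₁} ⋯ D_{h,t_n}`. -/
def chain (T : Mesh a b) (k : ℕ) (l : List ℝ) : Module.End ℝ (Vh T k) := (l.map (D T k)).prod

/-- The operator `D_{h,t_n}⁻¹ ⋯ D_{h,t₁}⁻¹` on `Z_h`. -/
def chainInv (l : List ℝ) (y : Vh T k) : Vh T k := l.foldl (fun v t => Dinv t v) y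

@[simp] lemma chain_nil : chain T k [] = 1 := rfl

lemma chain_cons (t : ℝ) (l : List ℝ) : chain T k (t :: l) = D T k t * chain T k l :=
  List.prod_cons

lemma chain_singleton (t : ℝ) : chain T k [t] = D T k t := by
  rw [chain, List.map_singleton, List.prod_singleton]

lemma chain_append (l l' : List ℝ) : chain T k (l ++ l') = chain T k l * chain T k l' := by
  rw [chain, List.map_append, List.prod_append, chain, chain]

lemma chainInv_cons (t : ℝ) (l : List ℝ) (y : Vh T k) :
    chainInv (t :: l) y = chainInv l (Dinv t y) := rfl

lemma chain_const {l : List ℝ} (hl : l ≠ []) (c : ℝ) : chain T k l (const c) = 0 := by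
  rw [← List.dropLast_append_getLast hl, chain_append, chain_singleton, Module.End.mul_apply,
    D_const, map_zero]

lemma chain_mem_zeroMean (l : List ℝ) {v : Vh T k} (hv : v ∈ zeroMean T k) :
    chain T k l v ∈ zeroMean T k := by
  cases l with
  | nil => exact hv
  | cons t l =>
    rw [chain_cons, Module.End.mul_apply]
    exact D_mem_zeroMean t _

lemma adjoint_chain (l : List ℝ) : LinearMap.adjoint (chain T k l) =
    (-1 : ℝ) ^ l.length • chain T k (l.map fun t => 1 - t).reverse := by
  induction l with
  | nil => simp
  | cons t l ih =>
    rw [chain_cons, Module.End.mul_eq_comp, LinearMap.adjoint_comp, ih, adjoint_D, List.map_cons,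
      List.reverse_cons, chain_append, chain_singleton, List.length_cons, pow_succ, mul_neg_one,
      neg_smul, ← Module.End.mul_eq_comp, smul_mul_assoc, mul_neg, smul_neg]

lemma exists_norm_le_norm_chain (a b : ℝ) (k : ℕ) {l : List ℝ} (hl : ∀ t ∈ l, t ≠ 1 / 2) :
    ∃ C : ℝ, 0 ≤ C ∧ ∀ (T : Mesh a b) (v : Vh T k), v ∈ zeroMean T k →
      ‖v‖ ≤ C * ‖chain T k l v‖ := by
  induction l with
  | nil => exact ⟨1, zero_le_one, fun T v _ => by simp⟩
  | cons t l ih =>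
    obtain ⟨ht, hl⟩ := List.forall_mem_cons.mp hl
    obtain ⟨C₁, hC₁, hchain⟩ := ih hl
    obtain ⟨C₂, hC₂, hD⟩ := exists_norm_le_norm_D a b k ht
    refine ⟨C₁ * C₂, by positivity, fun T v hv => (hchain T v hv).trans ?_⟩
    rw [chain_cons, Module.End.mul_apply, mul_assoc]
    exact mul_le_mul_of_nonneg_left (hD T _ (chain_mem_zeroMean l hv)) hC₁

lemma exists_norm_le_norm_chain_add_abs_inner (a b : ℝ) (k : ℕ) {l : List ℝ}
    (hl : ∀ t ∈ l, t ≠ 1 / 2) (hnil : l ≠ []) : ∃ C : ℝ, 0 ≤ C ∧ ∀ (T : Mesh a b) (v : Vh T k),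
      ‖v‖ ≤ C * (‖chain T k l v‖ + |⟪v, const 1⟫_ℝ|) := by
  obtain ⟨C, hC, hchain⟩ := exists_norm_le_norm_chain a b k hl
  refine ⟨C + 1 / √(b - a), by positivity, fun T v => ?_⟩
  have hdecomp := centered_add_const v
  have hpos : 0 < √(b - a) := Real.sqrt_pos.mpr (sub_pos.mpr T.lt)
  have hcentered : ‖centered v‖ ≤ C * ‖chain T k l v‖ := by
    have hv := hchain T _ (centered_mem v)
    rwa [eq_sub_of_add_eq hdecomp, map_sub, chain_const hnil, sub_zero,
      ← eq_sub_of_add_eq hdecomp] at hv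
  have hconst : ‖(const (⟪v, const 1⟫_ℝ / (b - a)) : Vh T k)‖ =
      1 / √(b - a) * |⟪v, const 1⟫_ℝ| := by
    rw [const_eq_smul, norm_smul, norm_const_one, norm_div, Real.norm_eq_abs, Real.norm_eq_abs,
      abs_of_pos (sub_pos.mpr T.lt), div_mul_eq_mul_div, mul_div_assoc, Real.sqrt_div_self',
      mul_comm]
  have hcross₁ : 0 ≤ 1 / √(b - a) * ‖chain T k l v‖ := by positivity
  have hcross₂ : 0 ≤ C * |⟪v, const 1⟫_ℝ| := by positivity
  have htriangle := norm_add_le (centered v) (const (⟪v, const 1⟫_ℝ / (b - a)))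
  rw [hdecomp, hconst] at htriangle
  linarith

lemma chainInv_spec {l : List ℝ} (hl : ∀ t ∈ l, t ≠ 1 / 2) {y : Vh T k} (hy : y ∈ zeroMean T k) :
    chainInv l y ∈ zeroMean T k ∧ chain T k l (chainInv l y) = y := by
  induction l generalizing y with
  | nil => exact ⟨hy, rfl⟩
  | cons t l ih =>
    obtain ⟨ht, hl⟩ := List.forall_mem_cons.mp hl
    obtain ⟨hDmem, hD⟩ := Dinv_spec ht hy
    obtain ⟨hmem, hchain⟩ := ih hl hDmem
    exact ⟨hmem, by rw [chainInv_cons, chain_cons, Module.End.mul_apply, hchain, hD]⟩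

lemma proj0_iteratedDeriv_mem_zeroMean {n i : ℕ} {W : ℝ} {w : ℝ → ℝ}
    (hw : BoundedSmooth a b n W w) (hi : i ≠ 0) (hin : i ≤ n) :
    proj0 T k (iteratedDeriv i w) ∈ zeroMean T k :=
  proj0_mem_zeroMean (hw.iterDeriv (m := 0) (by lia)).continuous (hw.integral_iteratedDeriv hi hin)

lemma exists_norm_chainInv_sub_le (a b : ℝ) (k : ℕ) {l : List ℝ} (hl : ∀ t ∈ l, t ≠ 1 / 2) :
    ∃ C : ℝ, 0 ≤ C ∧ ∀ (T : Mesh a b) (w : ℝ → ℝ) (W : ℝ),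
    BoundedSmooth a b (k + l.length) W w → ∀ y ∈ zeroMean T k,
    ‖chainInv l y - centered (proj0 T k w)‖ ≤
      C * (‖y - centered (proj0 T k (iteratedDeriv l.length w))‖ + W * T.h ^ (k + 1)) := by
  induction l with
  | nil =>
    refine ⟨1, zero_le_one, fun T w W hw y _ => ?_⟩
    have hWh : 0 ≤ W * T.h ^ (k + 1) := mul_nonneg hw.nonneg (pow_nonneg T.h_pos.le _)
    rw [List.length_nil, iteratedDeriv_zero, chainInv, List.foldl_nil]
    linarith
  | cons t l ih =>
    obtain ⟨ht, hl⟩ := List.forall_mem_cons.mp hl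
    obtain ⟨C₁, hC₁, hDinv⟩ := exists_norm_Dinv_sub_le a b k ht
    obtain ⟨C₂, hC₂, hchain⟩ := ih hl
    refine ⟨C₂ * (C₁ + 1), by positivity, fun T w W hw y hy => ?_⟩
    rw [List.length_cons] at hw ⊢
    have hmean : proj0 T k (iteratedDeriv (l.length + 1) w) ∈ zeroMean T k :=
      proj0_iteratedDeriv_mem_zeroMean hw (by lia) (by lia)
    rw [centered_eq_self hmean, chainInv_cons, mul_assoc]
    refine (hchain T w W (hw.of_le (by lia)) _ (Dinv_spec ht hy).1).trans
      (mul_le_mul_of_nonneg_left ?_ hC₂)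
    have hstep := hDinv T _ W (hw.iterDeriv (m := k + 1) (i := l.length) (by lia)) y hy
    rw [← iteratedDeriv_succ] at hstep
    linarith [norm_nonneg (y - proj0 T k (iteratedDeriv (l.length + 1) w))]

end Vh

namespace Vh

variable {a b : ℝ} {T : Mesh a b} {k : ℕ}

/-! ### The projection `Π` -/

/-- The projection `Π` for the operator `D_{h,t₁} ⋯ D_{h,t_n}`, where `l = [t₁, …, t_n]`. -/
def chainProj (T : Mesh a b) (k : ℕ) (l : List ℝ) (w : ℝ → ℝ) : Vh T k :=
  chainInv l (proj0 T k (iteratedDeriv l.length w)) + const ((∫ x in a..b, w x) / (b - a))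

section chainProj

variable {l : List ℝ} {W : ℝ} {w : ℝ → ℝ}

lemma chain_chainProj (hl : ∀ t ∈ l, t ≠ 1 / 2) (hnil : l ≠ [])
    (hw : BoundedSmooth a b l.length W w) :
    chain T k l (chainProj T k l w) = proj0 T k (iteratedDeriv l.length w) := by
  rw [chainProj, map_add, chain_const hnil, add_zero]
  exact (chainInv_spec hl <| proj0_iteratedDeriv_mem_zeroMean hw
    (List.length_pos_iff.mpr hnil).ne' le_rfl).2

lemma inner_chainProj_const_one (hl : ∀ t ∈ l, t ≠ 1 / 2) (hnil : l ≠ [])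
    (hw : BoundedSmooth a b l.length W w) :
    ⟪chainProj T k l w, const 1⟫_ℝ = ⟪proj0 T k w, const 1⟫_ℝ := by
  have hmem := (chainInv_spec hl <| proj0_iteratedDeriv_mem_zeroMean (T := T) (k := k) hw
    (List.length_pos_iff.mpr hnil).ne' le_rfl).1
  rw [chainProj, inner_add_left, mem_zeroMean.mp hmem, zero_add, const_eq_smul,
    real_inner_smul_left, real_inner_self_eq_norm_sq, norm_sq_const_one,
    div_mul_cancel₀ _ (sub_pos.mpr T.lt).ne', inner_proj0_const_one hw.continuous]

lemma exists_norm_chainProj_sub_proj0_le (a b : ℝ) (k : ℕ) (hl : ∀ t ∈ l, t ≠ 1 / 2)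
    (hnil : l ≠ []) : ∃ C : ℝ, 0 ≤ C ∧ ∀ (T : Mesh a b) (w : ℝ → ℝ) (W : ℝ),
    BoundedSmooth a b (k + l.length) W w →
    ‖chainProj T k l w - proj0 T k w‖ ≤ C * (W * T.h ^ (k + 1)) := by
  obtain ⟨C, hC, hchain⟩ := exists_norm_chainInv_sub_le a b k hl
  refine ⟨C, hC, fun T w W hw => ?_⟩
  have hmem : proj0 T k (iteratedDeriv l.length w) ∈ zeroMean T k :=
    proj0_iteratedDeriv_mem_zeroMean hw (List.length_pos_iff.mpr hnil).ne' (by lia)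
  have hdecomp := centered_add_const (proj0 T k w)
  rw [inner_proj0_const_one hw.continuous] at hdecomp
  have herror := hchain T w W hw _ hmem
  rw [centered_eq_self hmem, sub_self, norm_zero, zero_add] at herror
  rwa [chainProj, ← hdecomp, add_sub_add_right_eq_sub]

lemma exists_norm_chainProj_sub_sum_le (a b : ℝ) (k : ℕ) (hl : ∀ t ∈ l, t ≠ 1 / 2)
    (hnil : l ≠ []) : ∃ C : ℝ, 0 ≤ C ∧
    ∀ (T : Mesh a b) {ι : Type*} (s : Finset ι) (c : ι → ℝ) (f : ℝ → ℝ) (g : ι → ℝ → ℝ) (W E : ℝ),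
    BoundedSmooth a b l.length W f → (∀ i ∈ s, BoundedSmooth a b l.length W (g i)) →
    (∀ x, |f x - ∑ i ∈ s, c i * g i x| ≤ E) →
    (∀ x, |iteratedDeriv l.length f x - ∑ i ∈ s, c i * iteratedDeriv l.length (g i) x| ≤ E) →
    ‖chainProj T k l f - ∑ i ∈ s, c i • chainProj T k l (g i)‖ ≤ C * E := by
  obtain ⟨C, hC, hchain⟩ := exists_norm_le_norm_chain_add_abs_inner a b k hl hnil
  refine ⟨C * (√(b - a) + √(b - a) * √(b - a)), by positivity,
    fun T ι s c f g W E hf hg hE hE' => ?_⟩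
  have hcont {g : ℝ → ℝ} (hg : BoundedSmooth a b l.length W g) :
      Continuous (iteratedDeriv l.length g) := (hg.iterDeriv (m := 0) (by lia)).continuous
  have hchainSub : chain T k l (chainProj T k l f - ∑ i ∈ s, c i • chainProj T k l (g i)) =
      proj0 T k (fun x => iteratedDeriv l.length f x -
        ∑ i ∈ s, c i * iteratedDeriv l.length (g i) x) := by
    rw [proj0_sub_sum s c (hcont hf) fun i hi => hcont (hg i hi), map_sub, map_sum,
      chain_chainProj hl hnil hf]
    refine congrArg _ (Finset.sum_congr rfl fun i hi => ?_)
    rw [map_smul, chain_chainProj hl hnil (hg i hi)]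
  have hinnerSub : ⟪chainProj T k l f - ∑ i ∈ s, c i • chainProj T k l (g i), const 1⟫_ℝ =
      ⟪proj0 T k (fun x => f x - ∑ i ∈ s, c i * g i x), const 1⟫_ℝ := by
    rw [proj0_sub_sum s c hf.continuous fun i hi => (hg i hi).continuous, inner_sub_left,
      inner_sub_left, sum_inner, sum_inner, inner_chainProj_const_one hl hnil hf]
    refine congrArg _ (Finset.sum_congr rfl fun i hi => ?_)
    rw [real_inner_smul_left, real_inner_smul_left, inner_chainProj_const_one hl hnil (hg i hi)]
  refine (hchain T _).trans ?_
  rw [hchainSub, hinnerSub, mul_assoc, add_mul, mul_right_comm (√(b - a))]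
  refine mul_le_mul_of_nonneg_left (add_le_add (norm_proj0_le ?_ hE') ?_) hC
  · exact (hcont hf).sub
      (continuous_finsetSum s fun i hi => continuous_const.mul (hcont (hg i hi)))
  · refine (abs_real_inner_le_norm _ _).trans ?_
    rw [norm_const_one]
    refine mul_le_mul_of_nonneg_right (norm_proj0_le ?_ hE) (Real.sqrt_nonneg _)
    exact hf.continuous.sub
      (continuous_finsetSum s fun i hi => continuous_const.mul (hg i hi).continuous)

end chainProj

/-! ### The operator `L_h` -/

/-- The parameters of the factors of `L_h`, from left to right:
`1 - θ_γ, …, 1 - θ₁, (θ₀), θ₁, …, θ_γ`, where `θ₀` is present only for odd `q`. -/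
def params (q : ℕ) (θ₀ : ℝ) (θ : Fin (q / 2) → ℝ) : List ℝ :=
  ((List.ofFn θ).map (1 - ·)).reverse ++ (if Even q then [] else [θ₀]) ++ List.ofFn θ

lemma length_params (q : ℕ) (θ₀ : ℝ) (θ : Fin (q / 2) → ℝ) : (params q θ₀ θ).length = q := by
  simp only [params, List.length_append, List.length_reverse, List.length_map, List.length_ofFn,
    apply_ite List.length, List.length_nil, List.length_singleton, Nat.even_iff]
  split_ifs <;> lia

lemma params_ne_half {q : ℕ} {θ₀ : ℝ} {θ : Fin (q / 2) → ℝ} (hθ₀ : Odd q → θ₀ ≠ 1 / 2)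
    (hθ : ∀ i, θ i ≠ 1 / 2) : ∀ t ∈ params q θ₀ θ, t ≠ 1 / 2 := by
  intro t ht
  simp only [params, List.mem_append, List.mem_reverse, List.mem_map, List.mem_ofFn] at ht
  rcases ht with (⟨_, ⟨i, rfl⟩, rfl⟩ | ht) | ⟨i, rfl⟩
  · exact fun h => hθ i (by linarith)
  · split_ifs at ht with hq
    · exact absurd ht List.not_mem_nil
    · exact List.mem_singleton.mp ht ▸ hθ₀ (Nat.not_even_iff_odd.mp hq)
  · exact hθ i

lemma params_ne_nil {q : ℕ} (hq : q ≠ 0) (θ₀ : ℝ) (θ : Fin (q / 2) → ℝ) : params q θ₀ θ ≠ [] := by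
  rwa [ne_eq, ← List.length_eq_zero_iff, length_params]

lemma Lh_eq_chain (T : Mesh a b) (k q : ℕ) (β θ₀ : ℝ) (θ : Fin (q / 2) → ℝ) :
    Lh T k q β θ₀ θ = β • chain T k (params q θ₀ θ) := by
  have hK : K T k θ = chain T k (List.ofFn θ) := by
    rw [K, chain, List.map_ofFn]
    rfl
  have hsign : (-1 : ℝ) ^ (q / 2) * β * (-1) ^ (q / 2) = β := by
    rw [mul_right_comm, ← mul_pow, neg_one_mul, neg_neg, one_pow, one_mul]
  rw [Lh, hK, adjoint_chain, List.length_ofFn, params]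
  split_ifs with hq
  · rw [List.append_nil, chain_append, smul_mul_assoc, smul_smul, hsign]
  · rw [chain_append, chain_append, chain_singleton, smul_mul_assoc, smul_mul_assoc, smul_smul,
      hsign]

lemma proj_eq_chainProj (T : Mesh a b) (k q : ℕ) (θ₀ : ℝ) (θ : Fin (q / 2) → ℝ) (w : ℝ → ℝ) :
    proj T k q θ₀ θ w = chainProj T k (params q θ₀ θ) w := by
  rw [chainProj, length_params]
  simp only [proj, chainInv, params, List.foldl_append, List.foldl_reverse, List.foldr_map]
  split_ifs <;> rfl

section proj

variable {q : ℕ} {θ₀ : ℝ} {θ : Fin (q / 2) → ℝ}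

lemma Lh_proj (hq : q ≠ 0) (hθ₀ : Odd q → θ₀ ≠ 1 / 2) (hθ : ∀ i, θ i ≠ 1 / 2) {W β : ℝ}
    {w : ℝ → ℝ} (hw : BoundedSmooth a b q W w) :
    Lh T k q β θ₀ θ (proj T k q θ₀ θ w) = proj0 T k (Lop β q w) := by
  rw [Lh_eq_chain, proj_eq_chainProj, LinearMap.smul_apply, chain_chainProj
    (params_ne_half hθ₀ hθ) (params_ne_nil hq θ₀ θ) (by rwa [length_params]), length_params]
  exact (proj0_const_mul (hw.iterDeriv (m := 0) (by lia)).continuous β).symm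

lemma exists_norm_proj_sub_proj0_le (a b : ℝ) (k : ℕ) (hq : q ≠ 0) (hθ₀ : Odd q → θ₀ ≠ 1 / 2)
    (hθ : ∀ i, θ i ≠ 1 / 2) : ∃ C : ℝ, 0 ≤ C ∧ ∀ (T : Mesh a b) (w : ℝ → ℝ) (W : ℝ),
    BoundedSmooth a b (k + q) W w →
    ‖proj T k q θ₀ θ w - proj0 T k w‖ ≤ C * (W * T.h ^ (k + 1)) := by
  simpa only [length_params, ← proj_eq_chainProj] using exists_norm_chainProj_sub_proj0_le a b k
    (params_ne_half hθ₀ hθ) (params_ne_nil hq θ₀ θ)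

lemma exists_norm_proj_sub_sum_le (a b : ℝ) (k : ℕ) (hq : q ≠ 0) (hθ₀ : Odd q → θ₀ ≠ 1 / 2)
    (hθ : ∀ i, θ i ≠ 1 / 2) : ∃ C : ℝ, 0 ≤ C ∧
    ∀ (T : Mesh a b) {ι : Type*} (s : Finset ι) (c : ι → ℝ) (f : ℝ → ℝ) (g : ι → ℝ → ℝ) (W E : ℝ),
    BoundedSmooth a b q W f → (∀ i ∈ s, BoundedSmooth a b q W (g i)) →
    (∀ x, |f x - ∑ i ∈ s, c i * g i x| ≤ E) →
    (∀ x, |iteratedDeriv q f x - ∑ i ∈ s, c i * iteratedDeriv q (g i) x| ≤ E) →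
    ‖proj T k q θ₀ θ f - ∑ i ∈ s, c i • proj T k q θ₀ θ (g i)‖ ≤ C * E := by
  simpa only [length_params, ← proj_eq_chainProj] using exists_norm_chainProj_sub_sum_le a b k
    (params_ne_half hθ₀ hθ) (params_ne_nil hq θ₀ θ)

end proj

end Vh

/-! ### Space derivatives and time derivatives -/

lemma fwdDiff_iterate_sub (ε : ℝ) (n : ℕ) (f g : ℝ → ℝ) :
    (fwdDiff ε)^[n] (f - g) = (fwdDiff ε)^[n] f - (fwdDiff ε)^[n] g := by
  simp only [← fwdDiff_aux.coe_fwdDiffₗ_pow, map_sub]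

lemma exists_fwdDiff_iterate_eq {n : ℕ} {f : ℝ → ℝ} (hf : ContDiff ℝ n f) {ε : ℝ} (hε : 0 < ε)
    (x : ℝ) : ∃ ξ ∈ Icc x (x + n * ε), (fwdDiff ε)^[n] f x = ε ^ n * iteratedDeriv n f ξ := by
  induction n generalizing f with
  | zero => exact ⟨x, by simp, by simp⟩
  | succ n ih =>
    have hfn : ContDiff ℝ n f := hf.of_le (by exact_mod_cast Nat.le_succ n)
    have hshift : ContDiff ℝ n (fun y => f (y + ε)) := hfn.comp (contDiff_id.add contDiff_const)
    obtain ⟨ξ, hξ, hdiff⟩ := ih (f := fwdDiff ε f) (hshift.sub hfn)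
    have hderiv : iteratedDeriv n (fwdDiff ε f) ξ =
        iteratedDeriv n f (ξ + ε) - iteratedDeriv n f ξ := by
      rw [show fwdDiff ε f = fun y => f (y + ε) - f y from rfl,
        iteratedDeriv_fun_sub hshift.contDiffAt hfn.contDiffAt, iteratedDeriv_comp_add_const]
    have hd : Differentiable ℝ (iteratedDeriv n f) :=
      hf.differentiable_iteratedDeriv n (by exact_mod_cast Nat.lt_succ_self n)
    obtain ⟨η, hη, hslope⟩ := exists_deriv_eq_slope (iteratedDeriv n f) (by linarith : ξ < ξ + ε)
      hd.continuous.continuousOn hd.differentiableOn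
    refine ⟨η, ⟨by linarith [hξ.1, hη.1], ?_⟩, ?_⟩
    · push_cast
      linarith [hξ.2, hη.2]
    · rw [Function.iterate_succ_apply, hdiff, hderiv, iteratedDeriv_succ, hslope,
        add_sub_cancel_left, pow_succ, mul_assoc, mul_div_cancel₀ _ hε.ne']

lemma abs_fwdDiff_iterate_le {n : ℕ} {f : ℝ → ℝ} (hf : ContDiff ℝ n f) {K : ℝ}
    (hK : ∀ x, |iteratedDeriv n f x| ≤ K) {ε : ℝ} (hε : 0 < ε) (x : ℝ) :
    |(fwdDiff ε)^[n] f x| ≤ ε ^ n * K := by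
  obtain ⟨ξ, _, hξ⟩ := exists_fwdDiff_iterate_eq hf hε x
  rw [hξ, abs_mul, abs_of_pos (pow_pos hε n)]
  exact mul_le_mul_of_nonneg_left (hK ξ) (by positivity)

lemma abs_iteratedDeriv_le_of_abs_fwdDiff_iterate_le {n : ℕ} {f : ℝ → ℝ} (hf : ContDiff ℝ n f)
    {K x : ℝ} (hK : ∀ ε > 0, |(fwdDiff ε)^[n] f x| ≤ ε ^ n * K) : |iteratedDeriv n f x| ≤ K := by
  have hnear (m : ℕ) : ∃ ξ ∈ Icc x (x + n * (1 / ((m : ℝ) + 1))), |iteratedDeriv n f ξ| ≤ K := by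
    have hε : 0 < 1 / ((m : ℝ) + 1) := by positivity
    obtain ⟨ξ, hξ, hdiff⟩ := exists_fwdDiff_iterate_eq hf hε x
    have hle := hK _ hε
    rw [hdiff, abs_mul, abs_of_pos (pow_pos hε n)] at hle
    exact ⟨ξ, hξ, le_of_mul_le_mul_left hle (pow_pos hε n)⟩
  choose ξ hmem hle using hnear
  have hupper : Filter.Tendsto (fun m : ℕ => x + n * (1 / ((m : ℝ) + 1))) Filter.atTop (nhds x) :=
    by simpa using (tendsto_one_div_add_atTop_nhds_zero_nat.const_mul (n : ℝ)).const_add x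
  have hlim : Filter.Tendsto ξ Filter.atTop (nhds x) :=
    tendsto_of_tendsto_of_tendsto_of_le_of_le tendsto_const_nhds hupper
      (fun m => (hmem m).1) fun m => (hmem m).2
  exact le_of_tendsto (((hf.continuous_iteratedDeriv' n).abs.tendsto x).comp hlim)
    (Filter.Eventually.of_forall hle)

lemma hasDerivWithinAt_fwdDiff_iterate {s : Set ℝ} {t ε : ℝ} (n : ℕ) {f : ℝ → ℝ → ℝ} {g : ℝ → ℝ}
    (h : ∀ x, HasDerivWithinAt (fun r => f r x) (g x) s t) (x : ℝ) :
    HasDerivWithinAt (fun r => (fwdDiff ε)^[n] (f r) x) ((fwdDiff ε)^[n] g x) s t := by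
  induction n generalizing f g with
  | zero => exact h x
  | succ n ih =>
    simp only [Function.iterate_succ_apply]
    exact ih (f := fun r => fwdDiff ε (f r)) fun y => (h (y + ε)).sub (h y)

/- The mixed derivative `∂ₜ ∂ₓⁿ f` need not exist here. Iterated differences in `x` commute with
`∂ₜ`, so the mean value inequality in `t` applies to them before the increment tends to zero. -/
lemma abs_iteratedDeriv_sub_le {n : ℕ} {f g : ℝ → ℝ → ℝ} {I : Set ℝ} (hI : Convex ℝ I) {K : ℝ}
    (hfg : ∀ t ∈ I, ∀ x, HasDerivWithinAt (fun r => f r x) (g t x) I t)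
    (hf : ∀ t ∈ I, ContDiff ℝ n (f t)) (hg : ∀ t ∈ I, ContDiff ℝ n (g t))
    (hK : ∀ t ∈ I, ∀ x, |iteratedDeriv n (g t) x| ≤ K) {s t : ℝ} (hs : s ∈ I) (ht : t ∈ I)
    (x : ℝ) : |iteratedDeriv n (f t) x - iteratedDeriv n (f s) x| ≤ K * |t - s| := by
  suffices h : |iteratedDeriv n (f t - f s) x| ≤ K * |t - s| by
    rwa [iteratedDeriv_sub (hf t ht).contDiffAt (hf s hs).contDiffAt] at h
  refine abs_iteratedDeriv_le_of_abs_fwdDiff_iterate_le (f := f t - f s)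
    ((hf t ht).sub (hf s hs)) fun ε hε => ?_
  rw [fwdDiff_iterate_sub, ← mul_assoc]
  exact hI.norm_image_sub_le_of_norm_hasDerivWithin_le
    (fun r hr => hasDerivWithinAt_fwdDiff_iterate n (hfg r hr) x)
    (fun r hr => abs_fwdDiff_iterate_le (hg r hr) (hK r hr) hε x) hs ht

/-! ### Taylor expansion with a Lipschitz last derivative -/

lemma hasDerivAt_sub_pow_succ_div_factorial (i : ℕ) (t r : ℝ) :
    HasDerivAt (fun r => (r - t) ^ (i + 1) / (i + 1).factorial) ((r - t) ^ i / i.factorial) r := by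
  refine ((((hasDerivAt_id r).sub_const t).pow (i + 1)).div_const
    ((i + 1).factorial : ℝ)).congr_deriv ?_
  rw [Nat.factorial_succ, Nat.cast_mul, mul_one, Nat.add_sub_cancel, id,
    mul_div_mul_left _ _ (Nat.cast_ne_zero.mpr i.succ_ne_zero)]

lemma hasDerivAt_taylor_sum (n : ℕ) (c : ℕ → ℝ) (t r : ℝ) :
    HasDerivAt (fun r => ∑ i ∈ Finset.range (n + 1), (r - t) ^ i / i.factorial * c i)
      (∑ i ∈ Finset.range n, (r - t) ^ i / i.factorial * c (i + 1)) r := by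
  simp only [Finset.sum_range_succ' _ n, pow_zero]
  exact (HasDerivAt.fun_sum fun i _ =>
    (hasDerivAt_sub_pow_succ_div_factorial i t r).mul_const (c (i + 1))).add_const _

lemma abs_sub_taylor_sum_le {c d K : ℝ} (hK0 : 0 ≤ K) (p : ℕ) (φ : ℕ → ℝ → ℝ)
    (hφ : ∀ i < p, ∀ t ∈ Icc c d, HasDerivWithinAt (φ i) (φ (i + 1) t) (Icc c d) t)
    (hK : ∀ s ∈ Icc c d, ∀ t ∈ Icc c d, |φ p t - φ p s| ≤ K * |t - s|) {t τ : ℝ} (hτ : 0 ≤ τ)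
    (ht : t ∈ Icc c d) (htτ : t + τ ∈ Icc c d) :
    |φ 0 (t + τ) - ∑ i ∈ Finset.range (p + 1), τ ^ i / i.factorial * φ i t| ≤ K * τ ^ (p + 1) := by
  induction p generalizing φ τ with
  | zero => simpa [abs_of_nonneg hτ] using hK t ht _ htτ
  | succ p ih =>
    have hsub : Icc t (t + τ) ⊆ Icc c d := Icc_subset_Icc ht.1 htτ.2
    let remainder (r : ℝ) := φ 0 r - ∑ i ∈ Finset.range (p + 2), (r - t) ^ i / i.factorial * φ i t
    have hder (r : ℝ) (hr : r ∈ Icc t (t + τ)) : HasDerivWithinAt remainder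
        (φ 1 r - ∑ i ∈ Finset.range (p + 1), (r - t) ^ i / i.factorial * φ (i + 1) t)
        (Icc t (t + τ)) r :=
      ((hφ 0 p.succ_pos r (hsub hr)).mono hsub).sub
        (hasDerivAt_taylor_sum (p + 1) (φ · t) t r).hasDerivWithinAt
    have hbound (r : ℝ) (hr : r ∈ Icc t (t + τ)) :
        ‖φ 1 r - ∑ i ∈ Finset.range (p + 1), (r - t) ^ i / i.factorial * φ (i + 1) t‖ ≤
          K * τ ^ (p + 1) := by
      have hr0 : 0 ≤ r - t := sub_nonneg.mpr hr.1
      have hrτ : r - t ≤ τ := by linarith [hr.2]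
      have h := ih (fun i => φ (i + 1)) (fun i hi => hφ (i + 1) (by lia)) hK hr0
        (by rw [add_sub_cancel]; exact hsub hr)
      rw [add_sub_cancel] at h
      exact h.trans (by gcongr)
    have hmean := (convex_Icc t (t + τ)).norm_image_sub_le_of_norm_hasDerivWithin_le hder hbound
      (left_mem_Icc.mpr (by linarith)) (right_mem_Icc.mpr (by linarith))
    have hzero : remainder t = 0 := by
      simp only [remainder]
      rw [Finset.sum_range_succ']
      simp
    rw [hzero, sub_zero, add_sub_cancel_left, Real.norm_of_nonneg hτ, mul_assoc,
      ← pow_succ] at hmean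
    simpa only [remainder, add_sub_cancel_left, Real.norm_eq_abs] using hmean

/-! ### Sobolev embedding -/

lemma integral_abs_le_integral_sq_add {a b : ℝ} (hab : a ≤ b) {f : ℝ → ℝ} (hf : Continuous f) :
    ∫ x in a..b, |f x| ≤ (∫ x in a..b, f x ^ 2) + (b - a) := by
  have hmono := intervalIntegral.integral_mono_on (μ := MeasureTheory.volume) hab
    (hf.abs.intervalIntegrable a b)
    (Continuous.intervalIntegrable (by fun_prop : Continuous fun x => f x ^ 2 + 1) a b)
    fun x _ => by nlinarith [sq_nonneg (|f x| - 1), abs_nonneg (f x), sq_abs (f x)]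
  rwa [intervalIntegral.integral_add (Continuous.intervalIntegrable (by fun_prop) _ _)
    (Continuous.intervalIntegrable (by fun_prop) _ _), intervalIntegral.integral_const, smul_eq_mul,
    mul_one] at hmono

lemma abs_sub_le_integral_abs_deriv {a b : ℝ} {f f' : ℝ → ℝ} (hf : ∀ x, HasDerivAt f (f' x) x)
    (hf' : Continuous f') {x y : ℝ} (hx : x ∈ Icc a b) (hy : y ∈ Icc a b) :
    |f x - f y| ≤ ∫ z in a..b, |f' z| := by
  wlog hyx : y ≤ x generalizing x y
  · rw [abs_sub_comm]
    exact this hy hx (le_of_not_ge hyx)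
  rw [← intervalIntegral.integral_eq_sub_of_hasDerivAt (fun z _ => hf z)
    (hf'.intervalIntegrable _ _)]
  exact (intervalIntegral.abs_integral_le_integral_abs hyx).trans
    (intervalIntegral.integral_mono_interval hy.1 hyx hx.2
      (Filter.Eventually.of_forall fun _ => abs_nonneg _) (hf'.abs.intervalIntegrable _ _))

lemma mul_abs_le_integral_abs_add {a b : ℝ} {f f' : ℝ → ℝ} (hf : ∀ x, HasDerivAt f (f' x) x)
    (hf' : Continuous f') {x : ℝ} (hx : x ∈ Icc a b) :
    (b - a) * |f x| ≤ (∫ y in a..b, |f y|) + (b - a) * ∫ y in a..b, |f' y| := by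
  have hcont : Continuous f := continuous_iff_continuousAt.mpr fun x => (hf x).continuousAt
  have hmono := intervalIntegral.integral_mono_on (μ := MeasureTheory.volume) (hx.1.trans hx.2)
    (continuous_const.intervalIntegrable a b) (Continuous.intervalIntegrable (by fun_prop) a b)
    fun y hy => show |f x| ≤ |f y| + ∫ z in a..b, |f' z| by
      linarith [abs_sub_abs_le_abs_sub (f x) (f y), abs_sub_le_integral_abs_deriv hf hf' hx hy]
  rwa [intervalIntegral.integral_add (hcont.abs.intervalIntegrable _ _)
    (continuous_const.intervalIntegrable _ _), intervalIntegral.integral_const,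
    intervalIntegral.integral_const, smul_eq_mul, smul_eq_mul] at hmono

lemma integral_iteratedDeriv_sq_le {a b M : ℝ} (hab : a ≤ b) {m i : ℕ} {f : ℝ → ℝ}
    (hM : sobolevNorm a b m f ≤ M) (hi : i ≤ m) : ∫ x in a..b, iteratedDeriv i f x ^ 2 ≤ M ^ 2 :=
  (Finset.single_le_sum (f := fun i => ∫ x in a..b, iteratedDeriv i f x ^ 2)
    (fun _ _ => intervalIntegral.integral_nonneg hab fun _ _ => sq_nonneg _)
    (Finset.mem_range.mpr (Nat.lt_succ_of_le hi))).trans (Real.sqrt_le_iff.mp hM).2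

lemma exists_boundedSmooth_of_sobolevNorm_le {a b : ℝ} (hab : a < b) (M : ℝ) :
    ∃ W : ℝ, 0 ≤ W ∧ ∀ (n : ℕ) (f : ℝ → ℝ), ContDiff ℝ (n + 1 : ℕ) f →
      Function.Periodic f (b - a) → sobolevNorm a b (n + 1) f ≤ M → BoundedSmooth a b n W f := by
  have hpos : 0 < b - a := sub_pos.mpr hab
  refine ⟨(M ^ 2 + (b - a)) / (b - a) + (M ^ 2 + (b - a)), by positivity,
    fun n f hf hper hM => ⟨hf.of_le (by exact_mod_cast n.le_succ), hper, fun i hi x => ?_⟩⟩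
  have hcont (j : ℕ) (hj : j ≤ n + 1) : Continuous (iteratedDeriv j f) :=
    hf.continuous_iteratedDeriv j (by exact_mod_cast hj)
  have hderiv (y : ℝ) : HasDerivAt (iteratedDeriv i f) (iteratedDeriv (i + 1) f y) y := by
    rw [iteratedDeriv_succ]
    exact (hf.differentiable_iteratedDeriv i (by exact_mod_cast Nat.lt_succ_of_le hi)
      ).differentiableAt.hasDerivAt
  have hL1 (j : ℕ) (hj : j ≤ n + 1) : ∫ x in a..b, |iteratedDeriv j f x| ≤ M ^ 2 + (b - a) :=
    (integral_abs_le_integral_sq_add hab.le (hcont j hj)).trans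
      (by gcongr; exact integral_iteratedDeriv_sq_le hab.le hM hj)
  obtain ⟨y, hy, hxy⟩ := (periodic_iteratedDeriv hper i).exists_mem_Ico hpos x a
  rw [add_sub_cancel] at hy
  rw [hxy, div_add' _ _ _ hpos.ne', le_div_iff₀' hpos, mul_comm (M ^ 2 + (b - a))]
  exact (mul_abs_le_integral_abs_add hderiv (hcont (i + 1) (by lia))
    (Ico_subset_Icc_self hy)).trans (add_le_add (hL1 i (by lia))
      (mul_le_mul_of_nonneg_left (hL1 (i + 1) (by lia)) hpos.le))

/-! ### Bounds and expansions for smooth solutions -/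

lemma Lop_iterate (β : ℝ) (q i : ℕ) (w : ℝ → ℝ) :
    (Lop β q)^[i] w = fun x => β ^ i * iteratedDeriv (q * i) w x := by
  induction i with
  | zero => simp
  | succ i ih =>
    rw [Function.iterate_succ_apply', ih]
    ext x
    rw [Lop, iteratedDeriv_const_mul_field, iteratedDeriv_iteratedDeriv, ← mul_assoc, ← pow_succ',
      Nat.mul_succ, add_comm q]

lemma BoundedSmooth.Lop_iterate {a b W β : ℝ} {m n q i r : ℕ} {f : ℝ → ℝ}
    (hf : BoundedSmooth a b n W f) (hn : m + q * i ≤ n) (hir : i ≤ r) :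
    BoundedSmooth a b m ((1 + |β|) ^ r * W) ((Lop β q)^[i] f) := by
  have hderiv := hf.iterDeriv hn
  have hβ : |β| ^ i ≤ (1 + |β|) ^ r :=
    (pow_le_pow_left₀ (abs_nonneg β) (by linarith) i).trans
      (pow_le_pow_right₀ (by linarith [abs_nonneg β]) hir)
  rw [LDG.Lop_iterate]
  refine ⟨contDiff_const.mul hderiv.contDiff, fun x => by rw [hderiv.periodic x], fun l hl x => ?_⟩
  rw [iteratedDeriv_const_mul_field, abs_mul, abs_pow]
  exact mul_le_mul hβ (hderiv.bound l hl x) (abs_nonneg _) (by positivity)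

lemma exists_boundedSmooth_Lop_iterate {a b : ℝ} (hab : a < b) (β M : ℝ) (q r : ℕ) :
    ∃ W : ℝ, 0 ≤ W ∧ ∀ (n : ℕ) (f : ℝ → ℝ), ContDiff ℝ (n + q * r + 1 : ℕ) f →
      Function.Periodic f (b - a) → sobolevNorm a b (n + q * r + 1) f ≤ M →
      ∀ i ≤ r, BoundedSmooth a b n W ((Lop β q)^[i] f) := by
  obtain ⟨W, hW, hsobolev⟩ := exists_boundedSmooth_of_sobolevNorm_le hab M
  exact ⟨(1 + |β|) ^ r * W, by positivity, fun n f hf hper hM i hi =>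
    (hsobolev _ f hf hper hM).Lop_iterate (by gcongr) hi⟩

namespace IsSmoothSolution

variable {a b β tEnd W : ℝ} {q p m : ℕ} {u : ℝ → ℝ → ℝ}

lemma abs_sub_taylor_le (hu : IsSmoothSolution a b β q p m tEnd u)
    (hW : ∀ t ∈ Icc 0 tEnd, ∀ x, |(Lop β q)^[p + 1] (u t) x| ≤ W) {t τ : ℝ} (hτ : 0 ≤ τ)
    (ht : t ∈ Icc 0 tEnd) (htτ : t + τ ∈ Icc 0 tEnd) (x : ℝ) :
    |u (t + τ) x - ∑ i ∈ Finset.range (p + 1), τ ^ i / i.factorial * (Lop β q)^[i] (u t) x| ≤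
      W * τ ^ (p + 1) :=
  abs_sub_taylor_sum_le ((abs_nonneg _).trans (hW t ht x)) p (fun i r => (Lop β q)^[i] (u r) x)
    (fun i hi r hr => hu.time_deriv i hi.le r hr x)
    (fun _ hs _ ht => (convex_Icc _ _).norm_image_sub_le_of_norm_hasDerivWithin_le
      (fun r hr => hu.time_deriv p le_rfl r hr x) (fun r hr => hW r hr x) hs ht)
    hτ ht htτ

lemma apply_eq_of_zero (hu : IsSmoothSolution a b 0 q p m tEnd u) {r t : ℝ} (hr : r ∈ Icc 0 tEnd)
    (ht : t ∈ Icc 0 tEnd) : u r = u t := by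
  ext x
  have hmean := (convex_Icc 0 tEnd).norm_image_sub_le_of_norm_hasDerivWithin_le (C := 0)
    (fun r hr => hu.time_deriv 0 p.zero_le r hr x) (fun r _ => by simp [Lop]) ht hr
  rw [zero_mul] at hmean
  exact sub_eq_zero.mp (norm_le_zero_iff.mp hmean)

/- For `β ≠ 0`, `∂ₓ^q` is a multiple of `L`; for `β = 0`, the solution is stationary. -/
lemma hasDerivWithinAt_iteratedDeriv (hu : IsSmoothSolution a b β q p m tEnd u) {i : ℕ} (hi : i < p)
    {t : ℝ} (ht : t ∈ Icc 0 tEnd) (x : ℝ) :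
    HasDerivWithinAt (fun r => iteratedDeriv q ((Lop β q)^[i] (u r)) x)
      (iteratedDeriv q ((Lop β q)^[i + 1] (u t)) x) (Icc 0 tEnd) t := by
  rcases eq_or_ne β 0 with rfl | hβ
  · have hzero : iteratedDeriv q ((Lop 0 q)^[i + 1] (u t)) x = 0 := by
      simp [Lop_iterate]
    rw [hzero]
    exact (hasDerivWithinAt_const t (Icc 0 tEnd)
      (iteratedDeriv q ((Lop 0 q)^[i] (u t)) x)).congr_of_mem
      (fun r hr => by rw [hu.apply_eq_of_zero hr ht]) ht
  · have hLop (j : ℕ) (r : ℝ) : iteratedDeriv q ((Lop β q)^[j] (u r)) x =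
        β⁻¹ * (Lop β q)^[j + 1] (u r) x := by
      rw [Function.iterate_succ_apply', Lop, inv_mul_cancel_left₀ hβ]
    simp only [hLop]
    exact (hu.time_deriv (i + 1) (by lia) t ht x).const_mul β⁻¹

lemma abs_iteratedDeriv_sub_taylor_le (hu : IsSmoothSolution a b β q p m tEnd u)
    (hW : ∀ t ∈ Icc 0 tEnd, ∀ i ≤ p + 1, BoundedSmooth a b q W ((Lop β q)^[i] (u t))) {t τ : ℝ}
    (hτ : 0 ≤ τ) (ht : t ∈ Icc 0 tEnd) (htτ : t + τ ∈ Icc 0 tEnd) (x : ℝ) :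
    |iteratedDeriv q (u (t + τ)) x - ∑ i ∈ Finset.range (p + 1), τ ^ i / i.factorial *
      iteratedDeriv q ((Lop β q)^[i] (u t)) x| ≤ W * τ ^ (p + 1) :=
  abs_sub_taylor_sum_le (hW t ht 0 (Nat.zero_le _)).nonneg p
    (fun i r => iteratedDeriv q ((Lop β q)^[i] (u r)) x)
    (fun i hi r hr => hu.hasDerivWithinAt_iteratedDeriv hi hr x)
    (fun s hs r hr => abs_iteratedDeriv_sub_le (convex_Icc 0 tEnd)
      (f := fun r => (Lop β q)^[p] (u r)) (hu.time_deriv p le_rfl)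
      (fun r hr => (hW r hr p (by lia)).contDiff) (fun r hr => (hW r hr (p + 1) le_rfl).contDiff)
      (fun r hr => (hW r hr (p + 1) le_rfl).bound q le_rfl) hs hr x)
    hτ ht htτ

end IsSmoothSolution

/-! ### Time stepping -/

section Operators

variable {V : Type*} [NormedAddCommGroup V] [NormedSpace ℝ V] {A : Module.End ℝ V} {Λ : ℝ}

lemma norm_pow_apply_sub_le (hΛ : 1 ≤ Λ) (hA : ∀ v, ‖A v‖ ≤ Λ * ‖v‖) {z : ℕ → V} {δ : ℕ → ℝ}
    (hz : ∀ i, ‖A (z i) - z (i + 1)‖ ≤ δ i) (n : ℕ) :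
    ‖(A ^ n) (z 0) - z n‖ ≤ Λ ^ n * ∑ i ∈ Finset.range n, δ i := by
  induction n with
  | zero => simp
  | succ n ih =>
    have hδ : 0 ≤ δ n := (norm_nonneg _).trans (hz n)
    have hsplit : (A ^ (n + 1)) (z 0) - z (n + 1) =
        A ((A ^ n) (z 0) - z n) + (A (z n) - z (n + 1)) := by
      rw [pow_succ', Module.End.mul_apply, map_sub, sub_add_sub_cancel]
    calc ‖(A ^ (n + 1)) (z 0) - z (n + 1)‖
        ≤ Λ * ‖(A ^ n) (z 0) - z n‖ + δ n := by
          rw [hsplit]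
          exact norm_add_le_of_le (hA _) (hz n)
      _ ≤ Λ * (Λ ^ n * ∑ i ∈ Finset.range n, δ i) + Λ ^ (n + 1) * δ n := by
          gcongr
          exact le_mul_of_one_le_left hδ (one_le_pow₀ hΛ)
      _ = Λ ^ (n + 1) * ∑ i ∈ Finset.range (n + 1), δ i := by
          rw [Finset.sum_range_succ]
          ring

lemma norm_sum_smul_pow_apply_sub_le (hΛ : 1 ≤ Λ) (hA : ∀ v, ‖A v‖ ≤ Λ * ‖v‖) {z : ℕ → V}
    {δ : ℕ → ℝ} (hz : ∀ i, ‖A (z i) - z (i + 1)‖ ≤ δ i) (α : ℕ → ℝ) (s : ℕ) :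
    ‖∑ i ∈ Finset.range (s + 1), α i • (A ^ i) (z 0) - ∑ i ∈ Finset.range (s + 1), α i • z i‖ ≤
      (∑ i ∈ Finset.range (s + 1), |α i| * Λ ^ i) * ∑ i ∈ Finset.range s, δ i := by
  rw [← Finset.sum_sub_distrib, Finset.sum_mul]
  refine norm_sum_le_of_le _ fun i hi => ?_
  rw [← smul_sub, norm_smul, Real.norm_eq_abs, mul_assoc]
  gcongr
  refine (norm_pow_apply_sub_le hΛ hA hz i).trans ?_
  gcongr
  · exact fun j _ _ => (norm_nonneg _).trans (hz j)
  · exact Nat.le_of_lt_succ (Finset.mem_range.mp hi)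

lemma norm_sum_smul_pow_apply_sub_truncated_le (hΛ : 1 ≤ Λ) (hA : ∀ v, ‖A v‖ ≤ Λ * ‖v‖) {s p : ℕ}
    (hps : p ≤ s) {x : ℕ → V} {ε B : ℝ} (hx : ∀ i < p, ‖A (x i) - x (i + 1)‖ ≤ ε)
    (hxp : ‖A (x p)‖ ≤ B) (α : ℕ → ℝ) :
    ‖∑ i ∈ Finset.range (s + 1), α i • (A ^ i) (x 0) - ∑ i ∈ Finset.range (p + 1), α i • x i‖ ≤
      (∑ i ∈ Finset.range (s + 1), |α i| * Λ ^ i) * (p * ε + B) := by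
  let z (i : ℕ) : V := if i ≤ p then x i else 0
  let δ (i : ℕ) : ℝ := if i < p then ε else if i = p then B else 0
  have hz (i : ℕ) : ‖A (z i) - z (i + 1)‖ ≤ δ i := by
    rcases lt_trichotomy i p with hi | rfl | hi
    · simpa [z, δ, hi, hi.le, Nat.succ_le_of_lt hi] using hx i hi
    · simpa [z, δ] using hxp
    · simp [z, δ, hi.not_ge, hi.not_gt, hi.ne', (hi.trans i.lt_succ_self).not_ge]
  have hδ : ∑ i ∈ Finset.range s, δ i ≤ p * ε + B := by
    calc ∑ i ∈ Finset.range s, δ i ≤ ∑ i ∈ Finset.range (s + 1), δ i :=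
          Finset.sum_le_sum_of_subset_of_nonneg (by gcongr; lia)
            fun i _ _ => (norm_nonneg _).trans (hz i)
      _ = ∑ i ∈ Finset.range (p + 1), δ i :=
          (Finset.sum_subset (by gcongr) fun i _ hi => by
            rw [Finset.mem_range, not_lt] at hi
            simp [δ, show ¬ i < p by lia, show i ≠ p by lia]).symm
      _ = p * ε + B := by
          rw [Finset.sum_range_succ, Finset.sum_congr rfl fun i hi =>
            if_pos (Finset.mem_range.mp hi)]
          simp [δ]
  have hsum : ∑ i ∈ Finset.range (p + 1), α i • x i = ∑ i ∈ Finset.range (s + 1), α i • z i := by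
    rw [← Finset.sum_subset (Finset.range_mono (Nat.succ_le_succ hps))]
    · refine Finset.sum_congr rfl fun i hi => ?_
      simp only [z, if_pos (Nat.le_of_lt_succ (Finset.mem_range.mp hi))]
    · intro i _ hi
      simp only [z, if_neg fun h => hi (Finset.mem_range.mpr (Nat.lt_succ_of_le h)), smul_zero]
  have hz0 : z 0 = x 0 := if_pos p.zero_le
  rw [hsum, ← hz0]
  refine (norm_sum_smul_pow_apply_sub_le hΛ hA hz α s).trans ?_
  gcongr

lemma norm_sum_smul_pow_smul_apply_sub_taylor_le (hΛ : 1 ≤ Λ) {τ ε B : ℝ} (hτ : 0 ≤ τ) (hτ1 : τ ≤ 1)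
    (hA : ∀ v, ‖(τ • A) v‖ ≤ Λ * ‖v‖) {s p : ℕ} (hps : p ≤ s) {α : ℕ → ℝ}
    (hα : ∀ i ≤ p, α i = 1 / (i.factorial : ℝ)) {x : ℕ → V}
    (hx : ∀ i < p, ‖A (x i) - x (i + 1)‖ ≤ ε) (hxp : ‖A (x p)‖ ≤ B) :
    ‖∑ i ∈ Finset.range (s + 1), α i • ((τ • A) ^ i) (x 0) -
      ∑ i ∈ Finset.range (p + 1), (τ ^ i / i.factorial) • x i‖ ≤
      (∑ i ∈ Finset.range (s + 1), |α i| * Λ ^ i) * (p * (τ * ε) + τ ^ (p + 1) * B) := by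
  have happly (i : ℕ) : (τ • A) (τ ^ i • x i) = τ ^ (i + 1) • A (x i) := by
    rw [LinearMap.smul_apply, map_smul, smul_smul, ← pow_succ']
  have htaylor : ∑ i ∈ Finset.range (p + 1), (τ ^ i / i.factorial) • x i =
      ∑ i ∈ Finset.range (p + 1), α i • τ ^ i • x i :=
    Finset.sum_congr rfl fun i hi => by
      rw [hα i (Nat.le_of_lt_succ (Finset.mem_range.mp hi)), smul_smul, one_div_mul_eq_div]
  rw [htaylor]
  simpa only [pow_zero, one_smul] using norm_sum_smul_pow_apply_sub_truncated_le hΛ hA hps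
    (x := fun i => τ ^ i • x i) (ε := τ * ε) (B := τ ^ (p + 1) * B)
    (fun i hi => by
      rw [happly, ← smul_sub, norm_smul, norm_pow, Real.norm_of_nonneg hτ]
      exact mul_le_mul (pow_le_of_le_one hτ hτ1 i.succ_ne_zero) (hx i hi) (norm_nonneg _) hτ)
    (by
      rw [happly, norm_smul, norm_pow, Real.norm_of_nonneg hτ]
      gcongr) α

lemma sigma_nonneg {μ t : ℝ} (hμ : 0 ≤ μ) (ht : 0 ≤ t) : 0 ≤ sigma μ t := by
  rw [sigma]
  split_ifs
  · exact ht
  · exact div_nonneg (sub_nonneg.mpr (Real.one_le_exp (mul_nonneg hμ ht))) hμ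

lemma sigma_add_ge {μ t τ : ℝ} (hμ : 0 ≤ μ) :
    (1 + μ * τ) * sigma μ t + τ ≤ sigma μ (t + τ) := by
  rcases hμ.eq_or_lt with rfl | hpos
  · simp [sigma]
  · have hexp : (1 + μ * τ) * Real.exp (μ * t) ≤ Real.exp (μ * (t + τ)) := by
      rw [mul_add, add_comm (μ * t), Real.exp_add, add_comm 1]
      gcongr
      exact Real.add_one_le_exp _
    have hsum : (1 + μ * τ) * sigma μ t + τ = ((1 + μ * τ) * Real.exp (μ * t) - 1) / μ := by
      rw [sigma, if_neg hpos.ne']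
      field_simp
      ring
    rw [hsum, sigma, if_neg hpos.ne']
    gcongr

lemma norm_sub_le_sigma_mul {μ τ δ tEnd : ℝ} (hμ : 0 ≤ μ) (hτ : 0 ≤ τ) (hδ : 0 ≤ δ)
    (hA : ∀ v, ‖A v‖ ≤ (1 + μ * τ) * ‖v‖) {w z : ℕ → V} (h0 : w 0 = z 0)
    (hw : ∀ n, w (n + 1) = A (w n))
    (hz : ∀ n : ℕ, n * τ + τ ≤ tEnd → ‖A (z n) - z (n + 1)‖ ≤ τ * δ) (n : ℕ) (hn : n * τ ≤ tEnd) :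
    ‖w n - z n‖ ≤ sigma μ (n * τ) * δ := by
  induction n with
  | zero => simpa [h0] using mul_nonneg (sigma_nonneg hμ le_rfl) hδ
  | succ n ih =>
    rw [Nat.cast_succ, add_one_mul] at hn ⊢
    have hsplit : w (n + 1) - z (n + 1) = A (w n - z n) + (A (z n) - z (n + 1)) := by
      rw [hw, map_sub, sub_add_sub_cancel]
    calc ‖w (n + 1) - z (n + 1)‖
        ≤ (1 + μ * τ) * ‖w n - z n‖ + τ * δ := by
          rw [hsplit]
          exact norm_add_le_of_le (hA _) (hz n hn)
      _ ≤ (1 + μ * τ) * (sigma μ (n * τ) * δ) + τ * δ := by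
          gcongr
          exact ih (by linarith)
      _ = ((1 + μ * τ) * sigma μ (n * τ) + τ) * δ := by ring
      _ ≤ sigma μ (n * τ + τ) * δ := by
          gcongr
          exact sigma_add_ge hμ

end Operators

/-! ### Error estimates for the scheme -/

namespace Vh

variable {a b : ℝ} {T : Mesh a b} {k : ℕ}

lemma norm_apply_le_of_opNorm_le {A : Module.End ℝ (Vh T k)} {c : ℝ} (hA : opNorm A ≤ c)
    (v : Vh T k) : ‖A v‖ ≤ c * ‖v‖ :=
  (LinearMap.toContinuousLinearMap A).le_of_opNorm_le hA v

lemma norm_smul_apply_le_of_mul_opNorm_le {A : Module.End ℝ (Vh T k)} {τ c : ℝ} (hτ : 0 ≤ τ)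
    (hA : τ * opNorm A ≤ c) (v : Vh T k) : ‖(τ • A) v‖ ≤ c * ‖v‖ := by
  rw [LinearMap.smul_apply, norm_smul, Real.norm_of_nonneg hτ]
  calc τ * ‖A v‖ ≤ τ * (opNorm A * ‖v‖) := by
        gcongr
        exact norm_apply_le_of_opNorm_le le_rfl v
    _ = τ * opNorm A * ‖v‖ := (mul_assoc _ _ _).symm
    _ ≤ c * ‖v‖ := by gcongr

lemma R_apply (s : ℕ) (α : ℕ → ℝ) (τ : ℝ) (A : Module.End ℝ (Vh T k)) (v : Vh T k) :
    R s α τ A v = ∑ i ∈ Finset.range (s + 1), α i • ((τ • A) ^ i) v := by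
  simp [R, LinearMap.sum_apply]

section

variable {q : ℕ} {θ₀ : ℝ} {θ : Fin (q / 2) → ℝ}

lemma exists_norm_R_proj_sub_taylor_le (a b : ℝ) (k : ℕ) (hq : q ≠ 0) (hθ₀ : Odd q → θ₀ ≠ 1 / 2)
    (hθ : ∀ i, θ i ≠ 1 / 2) (β Λ : ℝ) {s p : ℕ} (hps : p ≤ s) {α : ℕ → ℝ}
    (hα : ∀ i ≤ p, α i = 1 / (i.factorial : ℝ)) : ∃ C : ℝ, 0 ≤ C ∧
    ∀ (T : Mesh a b) (w : ℝ → ℝ) (W τ : ℝ), 0 ≤ τ → τ ≤ 1 →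
    τ * opNorm (Lh T k q β θ₀ θ) ≤ Λ →
    (∀ i ≤ p + 1, BoundedSmooth a b (k + q) W ((Lop β q)^[i] w)) →
    ‖R s α τ (Lh T k q β θ₀ θ) (proj T k q θ₀ θ w) -
      ∑ i ∈ Finset.range (p + 1), (τ ^ i / i.factorial) • proj T k q θ₀ θ ((Lop β q)^[i] w)‖ ≤
      τ * (C * W * (T.h ^ (k + 1) + τ ^ p)) := by
  obtain ⟨C, hC, hproj⟩ := exists_norm_proj_sub_proj0_le a b k hq hθ₀ hθ
  set Λ' := max Λ 1
  set A := ∑ i ∈ Finset.range (s + 1), |α i| * Λ' ^ i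
  refine ⟨A * (p * C + √(b - a)), by positivity, fun T w W τ hτ hτ1 hτL hw => ?_⟩
  have hW : 0 ≤ W := (hw 0 (Nat.zero_le _)).nonneg
  have hh := T.h_pos
  have hL (i : ℕ) (hi : i ≤ p) : Lh T k q β θ₀ θ (proj T k q θ₀ θ ((Lop β q)^[i] w)) =
      proj0 T k ((Lop β q)^[i + 1] w) := by
    rw [Function.iterate_succ_apply']
    exact Lh_proj hq hθ₀ hθ ((hw i (by lia)).of_le (Nat.le_add_left q k))
  have hlast := hw (p + 1) le_rfl
  have hstep := norm_sum_smul_pow_smul_apply_sub_taylor_le (le_max_right Λ 1) hτ hτ1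
    (norm_smul_apply_le_of_mul_opNorm_le hτ (hτL.trans (le_max_left Λ 1))) hps hα
    (x := fun i => proj T k q θ₀ θ ((Lop β q)^[i] w)) (ε := C * (W * T.h ^ (k + 1)))
    (B := √(b - a) * W)
    (fun i hi => by
      rw [hL i hi.le, norm_sub_rev]
      exact hproj T _ W (hw (i + 1) (by lia)))
    (by
      rw [hL p le_rfl]
      exact norm_proj0_le hlast.continuous fun x => by simpa using hlast.bound 0 (Nat.zero_le _) x)
  rw [R_apply]
  refine hstep.trans ?_
  have hslack : 0 ≤ τ * (A * W * (p * C * τ ^ p + √(b - a) * T.h ^ (k + 1))) := by positivity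
  linear_combination hslack

lemma exists_norm_R_proj_sub_proj_le (a b : ℝ) (k : ℕ) (hq : q ≠ 0) (hθ₀ : Odd q → θ₀ ≠ 1 / 2)
    (hθ : ∀ i, θ i ≠ 1 / 2) (β Λ : ℝ) {s p : ℕ} (hps : p ≤ s) {α : ℕ → ℝ}
    (hα : ∀ i ≤ p, α i = 1 / (i.factorial : ℝ)) : ∃ C : ℝ, 0 ≤ C ∧
    ∀ (T : Mesh a b) {m : ℕ} {tEnd W : ℝ} {u : ℝ → ℝ → ℝ},
    IsSmoothSolution a b β q p m tEnd u →
    (∀ t ∈ Icc 0 tEnd, ∀ i ≤ p + 1, BoundedSmooth a b (k + q) W ((Lop β q)^[i] (u t))) →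
    ∀ {t τ : ℝ}, 0 ≤ τ → τ ≤ 1 → τ * opNorm (Lh T k q β θ₀ θ) ≤ Λ →
    t ∈ Icc 0 tEnd → t + τ ∈ Icc 0 tEnd →
    ‖R s α τ (Lh T k q β θ₀ θ) (proj T k q θ₀ θ (u t)) - proj T k q θ₀ θ (u (t + τ))‖ ≤
      τ * (C * W * (T.h ^ (k + 1) + τ ^ p)) := by
  obtain ⟨C₁, hC₁, hrungeKutta⟩ := exists_norm_R_proj_sub_taylor_le a b k hq hθ₀ hθ β Λ hps hα
  obtain ⟨C₂, hC₂, hstable⟩ := exists_norm_proj_sub_sum_le a b k hq hθ₀ hθ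
  refine ⟨C₁ + C₂, add_nonneg hC₁ hC₂, fun T m tEnd W u hu hW t τ hτ hτ1 hτL ht htτ => ?_⟩
  have hWq (r : ℝ) (hr : r ∈ Icc 0 tEnd) (i : ℕ) (hi : i ≤ p + 1) :
      BoundedSmooth a b q W ((Lop β q)^[i] (u r)) := (hW r hr i hi).of_le (Nat.le_add_left q k)
  have htaylor := hstable T (Finset.range (p + 1)) (fun i => τ ^ i / i.factorial) (u (t + τ))
    (fun i => (Lop β q)^[i] (u t)) W (W * τ ^ (p + 1)) (hWq _ htτ 0 (Nat.zero_le _))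
    (fun i hi => hWq t ht i (Finset.mem_range.mp hi).le)
    (hu.abs_sub_taylor_le (fun r hr x => by
      simpa using (hWq r hr (p + 1) le_rfl).bound 0 (Nat.zero_le _) x) hτ ht htτ)
    (hu.abs_iteratedDeriv_sub_taylor_le hWq hτ ht htτ)
  have hW0 : 0 ≤ W := (hW t ht 0 (Nat.zero_le _)).nonneg
  have hh := T.h_pos
  refine (norm_sub_le_norm_sub_add_norm_sub _ (∑ i ∈ Finset.range (p + 1),
    (τ ^ i / (i.factorial : ℝ)) • proj T k q θ₀ θ ((Lop β q)^[i] (u t))) _).trans ?_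
  rw [norm_sub_rev _ (proj T k q θ₀ θ (u (t + τ)))]
  calc _ ≤ τ * (C₁ * W * (T.h ^ (k + 1) + τ ^ p)) + C₂ * (W * τ ^ (p + 1)) :=
        add_le_add (hrungeKutta T (u t) W τ hτ hτ1 hτL (hW t ht)) htaylor
    _ = τ * (C₁ * W * (T.h ^ (k + 1) + τ ^ p)) + τ * (C₂ * W * (0 + τ ^ p)) := by ring
    _ ≤ τ * (C₁ * W * (T.h ^ (k + 1) + τ ^ p)) + τ * (C₂ * W * (T.h ^ (k + 1) + τ ^ p)) := by
        gcongr
        positivity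
    _ = τ * ((C₁ + C₂) * W * (T.h ^ (k + 1) + τ ^ p)) := by ring

lemma exists_l2Error_le (a b : ℝ) (k : ℕ) (hq : q ≠ 0) (hθ₀ : Odd q → θ₀ ≠ 1 / 2)
    (hθ : ∀ i, θ i ≠ 1 / 2) : ∃ C : ℝ, 0 ≤ C ∧ ∀ (T : Mesh a b) (w : ℝ → ℝ) (W : ℝ) (v : Vh T k),
    BoundedSmooth a b (k + q) W w →
    l2Error w v ≤ C * W * T.h ^ (k + 1) + 2 * ‖v - proj T k q θ₀ θ w‖ := by
  obtain ⟨C₁, hC₁, hproj0⟩ := exists_abs_sub_proj0_le k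
  obtain ⟨C₂, hC₂, hproj⟩ := exists_norm_proj_sub_proj0_le a b k hq hθ₀ hθ
  refine ⟨2 * (√(b - a) * C₁ + C₂), by positivity, fun T w W v hw => ?_⟩
  have hwk : BoundedSmooth a b (k + 1) W w := hw.of_le (by lia)
  have herror := l2Error_le hw.continuous (proj0 T k w) v
    (hproj0 a b T w W hwk.contDiff (hwk.bound _ le_rfl))
  have htriangle := norm_sub_le_norm_sub_add_norm_sub v (proj T k q θ₀ θ w) (proj0 T k w)
  rw [norm_sub_rev] at herror
  linarith [hproj T w W hw]

lemma exists_norm_sub_proj_le (a b : ℝ) (k : ℕ) (hq : q ≠ 0) (hθ₀ : Odd q → θ₀ ≠ 1 / 2)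
    (hθ : ∀ i, θ i ≠ 1 / 2) (β Λ : ℝ) {s p : ℕ} (hps : p ≤ s) {α : ℕ → ℝ}
    (hα : ∀ i ≤ p, α i = 1 / (i.factorial : ℝ)) : ∃ C : ℝ, 0 ≤ C ∧
    ∀ (T : Mesh a b) {m : ℕ} {tEnd W : ℝ} {u : ℝ → ℝ → ℝ},
    IsSmoothSolution a b β q p m tEnd u →
    (∀ t ∈ Icc 0 tEnd, ∀ i ≤ p + 1, BoundedSmooth a b (k + q) W ((Lop β q)^[i] (u t))) →
    ∀ {τ μh : ℝ}, 0 ≤ τ → τ ≤ 1 → 0 ≤ μh → τ * opNorm (Lh T k q β θ₀ θ) ≤ Λ →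
    opNorm (R s α τ (Lh T k q β θ₀ θ)) ≤ 1 + μh * τ →
    ∀ {uh : ℕ → Vh T k}, uh 0 = proj T k q θ₀ θ (u 0) →
    (∀ n, uh (n + 1) = R s α τ (Lh T k q β θ₀ θ) (uh n)) →
    ∀ n : ℕ, n * τ ≤ tEnd → ‖uh n - proj T k q θ₀ θ (u (n * τ))‖ ≤
      sigma μh (n * τ) * (C * W * (T.h ^ (k + 1) + τ ^ p)) := by
  obtain ⟨C, hC, hconsistent⟩ := exists_norm_R_proj_sub_proj_le a b k hq hθ₀ hθ β Λ hps hα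
  refine ⟨C, hC, fun T m tEnd W u hu hW τ μh hτ hτ1 hμ hτL hR uh huh0 huh n hn => ?_⟩
  have htEnd : 0 ≤ tEnd := le_trans (by positivity) hn
  have hW0 : 0 ≤ W := (hW 0 ⟨le_rfl, htEnd⟩ 0 (Nat.zero_le _)).nonneg
  have hh := T.h_pos
  refine norm_sub_le_sigma_mul (z := fun l => proj T k q θ₀ θ (u (l * τ))) hμ hτ (by positivity)
    (norm_apply_le_of_opNorm_le hR) (by simpa using huh0) huh (fun l hl => ?_) n hn
  rw [Nat.cast_succ, add_one_mul]
  exact hconsistent T hu hW hτ hτ1 hτL ⟨by positivity, by linarith⟩ ⟨by positivity, hl⟩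

end

end Vh

end LDG

end

open LDG LDG.Vh in
theorem mainTheorem2_general
    (a b : ℝ) (hab : a < b) (q : ℕ) (hq : 1 ≤ q) (β : ℝ)
    (θ₀ : ℝ) (θ : Fin (q / 2) → ℝ)
    (hθ₀ : Odd q → θ₀ ≠ 1 / 2) (hθ : ∀ i, θ i ≠ 1 / 2)
    (k : ℕ) (s p : ℕ) (hps : p ≤ s) (α : ℕ → ℝ) (hα : ∀ i ≤ p, α i = 1 / (i.factorial : ℝ))
    (Λ M : ℝ) :
    ∃ C : ℝ, 0 < C ∧
      ∀ (tEnd : ℝ) (u : ℝ → ℝ → ℝ), IsSmoothSolution a b β q p (k + 1 + q * (p + 2)) tEnd u →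
        (∀ t ∈ Set.Icc 0 tEnd, sobolevNorm a b (k + 1 + q * (p + 2)) (u t) ≤ M) →
      ∀ (T : Mesh a b) (τ μh : ℝ), 0 ≤ τ → τ ≤ 1 → 0 ≤ μh →
        τ * opNorm (Lh T k q β θ₀ θ) ≤ Λ →
        opNorm (R s α τ (Lh T k q β θ₀ θ)) ≤ 1 + μh * τ →
      ∀ uh : ℕ → Vh T k, uh 0 = proj T k q θ₀ θ (u 0) →
        (∀ n, uh (n + 1) = R s α τ (Lh T k q β θ₀ θ) (uh n)) →
      ∀ n : ℕ, n * τ ≤ tEnd →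
        l2Error (u (n * τ)) (uh n) ≤ C * (sigma μh (n * τ) + 1) * (T.h ^ (k + 1) + τ ^ p) := by
  have hq0 : q ≠ 0 := Nat.one_le_iff_ne_zero.mp hq
  obtain ⟨W, hW, hsmooth⟩ := exists_boundedSmooth_Lop_iterate hab β M q (p + 1)
  obtain ⟨C₁, hC₁, hl2Error⟩ := exists_l2Error_le a b k hq0 hθ₀ hθ
  obtain ⟨C₂, hC₂, hscheme⟩ := exists_norm_sub_proj_le a b k hq0 hθ₀ hθ β Λ hps hα
  refine ⟨C₁ * W + 2 * (C₂ * W) + 1, by positivity, ?_⟩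
  intro tEnd u hu hM T τ μh hτ hτ1 hμ hτL hR uh huh0 huh n hn
  have hLu : ∀ t ∈ Set.Icc 0 tEnd, ∀ i ≤ p + 1,
      BoundedSmooth a b (k + q) W ((Lop β q)^[i] (u t)) := by
    rw [show k + 1 + q * (p + 2) = k + q + q * (p + 1) + 1 by ring] at hu hM
    exact fun t ht => hsmooth (k + q) (u t) (hu.contDiff t ht) (hu.periodic t ht) (hM t ht)
  have ht : n * τ ∈ Set.Icc 0 tEnd := ⟨by positivity, hn⟩
  have hσ : 0 ≤ sigma μh (n * τ) := sigma_nonneg hμ ht.1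
  have hh := T.h_pos
  calc l2Error (u (n * τ)) (uh n)
      ≤ C₁ * W * T.h ^ (k + 1) + 2 * ‖uh n - proj T k q θ₀ θ (u (n * τ))‖ :=
        hl2Error T _ W _ (hLu _ ht 0 (Nat.zero_le _))
    _ ≤ C₁ * W * T.h ^ (k + 1) +
          2 * (sigma μh (n * τ) * (C₂ * W * (T.h ^ (k + 1) + τ ^ p))) := by
        gcongr
        exact hscheme T hu hLu hτ hτ1 hμ hτL hR huh0 huh n hn
    _ ≤ (C₁ * W + 2 * (C₂ * W) + 1) * (sigma μh (n * τ) + 1) * (T.h ^ (k + 1) + τ ^ p) := by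
        have hslack : 0 ≤ C₁ * W * (sigma μh (n * τ) * (T.h ^ (k + 1) + τ ^ p) + τ ^ p) +
          (2 * (C₂ * W) + sigma μh (n * τ) + 1) * (T.h ^ (k + 1) + τ ^ p) := by positivity
        linear_combination hslack

theorem mainTheorem2
    -- the domain, the equation and the flux parameters
    (a b : ℝ) (hab : a < b) (q : ℕ) (hq : 1 ≤ q) (β : ℝ)
    (θ₀ : ℝ) (θ : Fin (q / 2) → ℝ)
    (hθ₀ : Odd q → θ₀ ≠ 1 / 2) (hθ : ∀ i, θ i ≠ 1 / 2)
    -- the polynomial degree and the Runge-Kutta method of linear order `p`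
    (k : ℕ) (s p : ℕ) (hp : 1 ≤ p) (hps : p ≤ s) (α : ℕ → ℝ)
    (hα : ∀ i ≤ p, α i = 1 / (i.factorial : ℝ))
    -- the quasi-uniformity constant and the bound for the Sobolev norm of the solution
    (ρ M : ℝ) :
    ∃ C : ℝ, 0 < C ∧
      ∀ (tEnd : ℝ) (u : ℝ → ℝ → ℝ),
        LDG.IsSmoothSolution a b β q p (k + 1 + q * (p + 2)) tEnd u →
        (∀ t ∈ Set.Icc 0 tEnd, LDG.sobolevNorm a b (k + 1 + q * (p + 2)) (u t) ≤ M) →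
      ∀ T : LDG.Mesh a b, T.QuasiUniform ρ →
      ∀ (τ lam μh : ℝ), 0 < τ → τ ≤ 1 → lam < 1 → 0 ≤ μh →
        τ * LDG.Vh.opNorm (LDG.Vh.Lh T k q β θ₀ θ) ≤ lam →
        LDG.Vh.opNorm (LDG.Vh.R s α τ (LDG.Vh.Lh T k q β θ₀ θ)) ≤ 1 + μh * τ →
      ∀ uh : ℕ → LDG.Vh T k,
        uh 0 = LDG.Vh.proj T k q θ₀ θ (u 0) →
        (∀ n, uh (n + 1) = LDG.Vh.R s α τ (LDG.Vh.Lh T k q β θ₀ θ) (uh n)) →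
      ∀ n : ℕ, n * τ ≤ tEnd →
        LDG.Vh.l2Error (u (n * τ)) (uh n) ≤
          C * (LDG.sigma μh (n * τ) + 1) * (T.h ^ (k + 1) + τ ^ p) := by
  obtain ⟨C, hC, herror⟩ := mainTheorem2_general a b hab q hq β θ₀ θ hθ₀ hθ k s p hps α hα 1 M
  exact ⟨C, hC, fun tEnd u hu hM T _ τ lam μh hτ hτ1 hlam hμ hτL =>
    herror tEnd u hu hM T τ μh hτ.le hτ1 hμ (hτL.trans hlam.le)⟩
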